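/- Let $m,N\ge 1$ and let $\alpha_1,\dots,\alpha_m,\beta_1,\dots,\beta_N$ be real numbers with $\alpha_i+\beta_j>0$ for all $i,j$. Let $\omega_{i,j}$ ($1\le i\le m$, $1\le j\le N$) be independent random variables, $\omega_{i,j}$ being exponentially distributed with rate $\alpha_i+\beta_j$. Write $\mathbb W_N(\mathbb R)=\{z\in\mathbb R^N: z_1\le z_2\le\cdots\le z_N\}$, let $x\in\mathbb W_N(\mathbb R)$ and let $c\in[-\infty,x_1]$ (for example $c=-\infty$, or $c=0$ when $x_1\ge 0$). Let $G$ be the growth function given by $$G(0,n)=x_n,\qquad G(k,0)=c\ (k\ge 1),\qquad G(k,n)=\max\{G(k-1,n),\,G(k,n-1)\}+\omega_{k,n}\quad(1\le k\le m,\ 1\le n\le N),$$ and put $\vec G(m)=(G(m,1),\dots,G(m,N))$. Fix $R>\max_{k,\ell}\{\alpha_k,\beta_\ell\}$ and define, for $1\le i,j\le N$ and $y\in\mathbb W_N(\mathbb R)$, $$M_{\mathrm{Exp}}(i,j\,|\,x,y)=\mathbf 1_{\{y_j\ge x_i\}}\;\frac1{2\pi \mathrm i}\oint_{|z|=R} e^{\,y_j(z-\beta_j)-x_i(z-\beta_i)}\;\frac{\prod_{k=1}^{j}(z-\beta_k)}{\prod_{k=1}^{i}(z-\beta_k)}\;\prod_{k=1}^m\frac{\alpha_k+\beta_j}{z+\alpha_k}\,dz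 ,$$ the circle being oriented counter-clockwise. Then $\det[M_{\mathrm{Exp}}(i,j\,|\,x,y)]_{i,j=1}^N$ is real and non-negative for every $y\in\mathbb W_N(\mathbb R)$, and the law of $\vec G(m)$ started from $\vec G(0)=x$ is supported on $\mathbb W_N(\mathbb R)$ and has there the density $y\mapsto\det[M_{\mathrm{Exp}}(i,j\,|\,x,y)]_{i,j}$ with respect to Lebesgue measure: $$\mathbb P\big(\vec G(m)\in dy \,\big|\, \vec G(0)=x\big)=\det\big[M_{\mathrm{Exp}}(i,j\,|\,x,y)\big]_{i,j}\,dy .$$ -/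

import Mathlib

open MeasureTheory ProbabilityTheory

/-- The real Weyl chamber `{z ∈ ℝ^N : z₁ ≤ z₂ ≤ ⋯ ≤ z_N}`. -/
def weylChamber (N : ℕ) : Set (Fin N → ℝ) := {z | Monotone z}

/-- The growth function `G` of last passage percolation for one realisation `w` of the weights.
Columns and rows are numbered from `1`. The initial values are `G(0,n) = x n` and the boundary
values are `G(k,0) = c` for `k ≥ 1`, where `c = -∞` is allowed; otherwise
`G(k,n) = max (G(k-1,n)) (G(k,n-1)) + w k n`. -/
def growth (c : WithBot ℝ) (x : ℕ → ℝ) (w : ℕ → ℕ → ℝ) : ℕ → ℕ → WithBot ℝ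
  | 0, n => (x n : WithBot ℝ)
  | _ + 1, 0 => c
  | k + 1, n + 1 =>
      max (growth c x w k (n + 1)) (growth c x w (k + 1) n) + (w (k + 1) (n + 1) : WithBot ℝ)

/-- `G(k,n)` is a real number for every `n ≥ 1`. -/
theorem growth_ne_bot (c : WithBot ℝ) (x : ℕ → ℝ) (w : ℕ → ℕ → ℝ) (k n : ℕ) :
    growth c x w k (n + 1) ≠ ⊥ := by
  induction k with
  | zero => simp [growth]
  | succ k ih => simp [growth, WithBot.add_eq_bot, ih]

/-- The vector `(G(m,1), …, G(m,N))`; the default `0` is never used, by `growth_ne_bot`. -/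
noncomputable def growthVec (N : ℕ) (c : WithBot ℝ) (x : ℕ → ℝ) (w : ℕ → ℕ → ℝ) (m : ℕ) :
    Fin N → ℝ :=
  fun j => (growth c x w m ((j : ℕ) + 1)).unbotD 0

/-- The entry `M_Exp(i,j | x,y)`, as a function of the two coordinates `xi = x_i` and `yj = y_j` on
which it depends. The contour is the circle `|z| = R`, oriented counter-clockwise. -/
noncomputable def expEntry (α β : ℕ → ℝ) (m : ℕ) (R : ℝ) (i j : ℕ) (xi yj : ℝ) : ℂ :=
  if xi ≤ yj then
    (2 * (Real.pi : ℂ) * Complex.I)⁻¹ * ∮ z in C(0, R),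
      Complex.exp ((yj : ℂ) * (z - (β j : ℂ)) - (xi : ℂ) * (z - (β i : ℂ))) *
        ((∏ k ∈ Finset.Icc 1 j, (z - (β k : ℂ))) / (∏ k ∈ Finset.Icc 1 i, (z - (β k : ℂ)))) *
        ∏ k ∈ Finset.Icc 1 m, (((α k : ℂ) + (β j : ℂ)) / (z + (α k : ℂ)))
  else 0

/-- The `N × N` matrix `M_Exp(i,j | x,y)`, with `i` and `j` running through `1, …, N`. -/
noncomputable def expMatrix (N : ℕ) (α β : ℕ → ℝ) (m : ℕ) (R : ℝ) (x : ℕ → ℝ) (y : Fin N → ℝ) :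
    Matrix (Fin N) (Fin N) ℂ :=
  Matrix.of fun i j =>
    expEntry α β m R ((i : ℕ) + 1) ((j : ℕ) + 1) (x ((i : ℕ) + 1)) (y j)

/-! The rows of `G` form a Markov chain: given row `y`, the next row is `z_j = max (y_j) (z_{j-1}) +
w_j` with independent exponential `w_j`. This map from weights to `z` is a triangular shear, so the
transition density is the product `stepDensity`. Since `G(k,1) ≥ x_1 ≥ c` almost surely, the
boundary value never matters and can be replaced by any `L < x_1`. The law of `G(m)` is then found
by induction on `m ≥ 1`; what has to be shown is that the determinants reproduce themselves under
the one-step kernel, and that the first one equals the one-step density. Reality and non-negativity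
come for free, because each determinant is the integral of the preceding non-negative one against a
non-negative kernel.

Up to row and column factors the matrix entries are values at `y_j - x_i` of contour integrals
`F_{m,i,j}(t)`, cut off at `t < 0`. Multiplying the integrand by `z - β_{j+1}` or by `z + α_{m+1}`
is a first-order differential operator in `t`, so the `F` are primitives of each other. Moreover
`F_{m,i,j} - F_{m+1,i,j+1} = (α_{m+1} + β_{j+1}) F_{m+1,i,j}`. These relations integrate one column
against its share of the one-step density in closed form (`integral_stepWeight_mul_causalFun`).

In the convolution the coordinates of `y` are integrated from the last to the first, `y_n` running
over `[y_{n-1}, z_n]`. The boundary term at `y_{n-1}` is a multiple of the preceding column and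
disappears from the determinant; where the closed form fails because of the cut-off, a zero block
kills the error (`det_updateCol_integral_stepCol`). A final column operation (`det_stepImage`)
yields the determinant for `m + 1`. For `m = 1` the same column operation, run from a formal
zero-step kernel, makes the determinant a product of diagonal entries (`det_expMatrix_one`). -/

/-! ### Contour integrals and the relations between them -/

theorem hasDerivAt_circleIntegral_exp_mul {R : ℝ} (hR : 0 ≤ R) {g : ℂ → ℂ}
    (hg : ContinuousOn g (Metric.sphere 0 R)) (t : ℝ) :
    HasDerivAt (fun t : ℝ => ∮ z in C(0, R), Complex.exp (t * z) * g z)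
      (∮ z in C(0, R), Complex.exp (t * z) * (z * g z)) t := by
  have hgc : Continuous fun θ : ℝ => g (circleMap 0 R θ) :=
    hg.comp_continuous (continuous_circleMap 0 R) fun θ => circleMap_mem_sphere 0 hR θ
  have hc := continuous_circleMap 0 R
  have hd : Continuous fun θ : ℝ => deriv (circleMap 0 R) θ := by
    simp only [deriv_circleMap]
    exact hc.mul continuous_const
  have he : ∀ t : ℝ, Continuous fun θ : ℝ => Complex.exp (t * circleMap 0 R θ) := fun t =>
    Complex.continuous_exp.comp (continuous_const.mul hc)
  have hF : ∀ t : ℝ, Continuous fun θ : ℝ => deriv (circleMap 0 R) θ •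
      (Complex.exp (t * circleMap 0 R θ) * g (circleMap 0 R θ)) := fun t =>
    hd.smul ((he t).mul hgc)
  have hF' : Continuous fun θ : ℝ => deriv (circleMap 0 R) θ •
      (Complex.exp (t * circleMap 0 R θ) * (circleMap 0 R θ * g (circleMap 0 R θ))) :=
    hd.smul ((he t).mul (hc.mul hgc))
  have hB : Continuous fun θ : ℝ => Real.exp ((|t| + 1) * R) *
      ‖deriv (circleMap 0 R) θ * (circleMap 0 R θ * g (circleMap 0 R θ))‖ :=
    continuous_const.mul (hd.mul (hc.mul hgc)).norm
  refine (intervalIntegral.hasDerivAt_integral_of_dominated_loc_of_deriv_le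
    (F := fun (t : ℝ) (θ : ℝ) => deriv (circleMap 0 R) θ •
      (Complex.exp (t * circleMap 0 R θ) * g (circleMap 0 R θ)))
    (F' := fun (t : ℝ) (θ : ℝ) => deriv (circleMap 0 R) θ •
      (Complex.exp (t * circleMap 0 R θ) * (circleMap 0 R θ * g (circleMap 0 R θ))))
    (Metric.ball_mem_nhds t one_pos)
    (Filter.Eventually.of_forall fun s => (hF s).aestronglyMeasurable)
    ((hF t).intervalIntegrable _ _) hF'.aestronglyMeasurable
    (Filter.Eventually.of_forall fun θ _ s hs => ?_) (hB.intervalIntegrable _ _)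
    (Filter.Eventually.of_forall fun θ _ s _ => ?_)).2
  · have hst : |s| ≤ |t| + 1 := by
      have h1 : |s - t| < 1 := by simpa [Real.dist_eq] using hs
      have h2 := abs_sub_abs_le_abs_sub s t
      linarith
    have hre : ((s : ℂ) * circleMap 0 R θ).re ≤ (|t| + 1) * R := by
      calc ((s : ℂ) * circleMap 0 R θ).re ≤ ‖(s : ℂ) * circleMap 0 R θ‖ := Complex.re_le_norm _
        _ = |s| * R := by simp [abs_of_nonneg hR]
        _ ≤ (|t| + 1) * R := by gcongr
    have : ‖Complex.exp ((s : ℂ) * circleMap 0 R θ)‖ ≤ Real.exp ((|t| + 1) * R) := by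
      rw [Complex.norm_exp]
      exact Real.exp_le_exp.2 hre
    rw [smul_eq_mul, mul_left_comm, norm_mul]
    gcongr
  · have h1 : HasDerivAt (fun s : ℝ => (s : ℂ) * circleMap 0 R θ) (1 * circleMap 0 R θ) s :=
      (Complex.ofRealCLM.hasDerivAt (x := s)).mul_const _
    refine (((h1.cexp).mul_const (g (circleMap 0 R θ))).const_smul
      (deriv (circleMap 0 R) θ)).congr_deriv ?_
    simp only [smul_eq_mul]
    ring

/-- All poles lie inside the circle, so its radius may be sent to infinity, and the integrand is
`O(r⁻²)` on a circle of length `2πr`. -/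
theorem circleIntegral_prod_inv_sub_eq_zero {ι : Type*} (s : Finset ι) (w : ι → ℂ) {R : ℝ}
    (hR : 0 < R) (hw : ∀ k ∈ s, ‖w k‖ < R) (hs : 2 ≤ s.card) :
    (∮ z in C(0, R), ∏ k ∈ s, (z - w k)⁻¹) = 0 := by
  have hne : ∀ z : ℂ, R ≤ ‖z‖ → ∀ k ∈ s, z - w k ≠ 0 := by
    intro z hz k hk h
    rw [sub_eq_zero] at h
    have := hw k hk
    rw [← h] at this
    linarith
  have hdiff : ∀ z : ℂ, R ≤ ‖z‖ → DifferentiableAt ℂ (fun z => ∏ k ∈ s, (z - w k)⁻¹) z := by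
    intro z hz
    refine DifferentiableAt.fun_finsetProd fun k hk => ?_
    exact (differentiableAt_id.sub_const _).inv (hne z hz k hk)
  have hind : ∀ r : ℝ, R ≤ r → (∮ z in C(0, r), ∏ k ∈ s, (z - w k)⁻¹) =
      ∮ z in C(0, R), ∏ k ∈ s, (z - w k)⁻¹ := by
    intro r hr
    refine Complex.circleIntegral_eq_of_differentiable_on_annulus_off_countable hR hr
      Set.countable_empty (fun z hz => (hdiff z ?_).continuousAt.continuousWithinAt)
      (fun z hz => hdiff z ?_)
    · simpa using hz.2
    · have := hz.1.2
      simp only [Metric.mem_closedBall, dist_zero_right, not_le] at this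
      exact this.le
  -- For such `r` each factor is at most `2 / r ≤ 1`, so all but two may be dropped, and `2πr (2/r)²
  -- = 8π/r`.
  have hbound : ∀ r : ℝ, 2 * R + 2 ≤ r →
      ‖∮ z in C(0, R), ∏ k ∈ s, (z - w k)⁻¹‖ ≤ 8 * Real.pi * r⁻¹ := by
    intro r hr
    have hr0 : 0 < r := by linarith
    rw [← hind r (by linarith)]
    have := circleIntegral.norm_integral_le_of_norm_le_const (c := 0) (R := r) (C := (2 / r) ^ 2)
      (f := fun z => ∏ k ∈ s, (z - w k)⁻¹) hr0.le ?_
    · refine this.trans (le_of_eq ?_)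
      field_simp
      ring
    · intro z hz
      have hz' : ‖z‖ = r := by simpa using hz
      rw [norm_prod]
      calc ∏ k ∈ s, ‖(z - w k)⁻¹‖ ≤ ∏ _k ∈ s, (2 / r) := by
            refine Finset.prod_le_prod (fun _ _ => norm_nonneg _) fun k hk => ?_
            rw [norm_inv, ← inv_div]
            refine inv_anti₀ (by positivity) ?_
            have h1 := norm_sub_norm_le z (w k)
            have h2 := hw k hk
            linarith
        _ = (2 / r) ^ s.card := Finset.prod_const _
        _ ≤ (2 / r) ^ 2 := by
            refine pow_le_pow_of_le_one (by positivity) ?_ hs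
            rw [div_le_one hr0]
            linarith
  have hlim : Filter.Tendsto (fun r : ℝ => 8 * Real.pi * r⁻¹) Filter.atTop (nhds 0) := by
    simpa using tendsto_inv_atTop_zero.const_mul (8 * Real.pi)
  have := ge_of_tendsto hlim (Filter.eventually_atTop.2 ⟨2 * R + 2, hbound⟩)
  exact norm_le_zero_iff.1 this

/-- The rational factor of the contour integrand. -/
noncomputable def contourRat (α β : ℕ → ℝ) (m i j : ℕ) (z : ℂ) : ℂ :=
  (∏ k ∈ Finset.Icc 1 j, (z - (β k : ℂ))) / (∏ k ∈ Finset.Icc 1 i, (z - (β k : ℂ))) *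
    ∏ k ∈ Finset.Icc 1 m, (z + (α k : ℂ))⁻¹

/-- The contour integral of `exp (t z)` times the rational factor. -/
noncomputable def contourFun (α β : ℕ → ℝ) (R : ℝ) (m i j : ℕ) (t : ℝ) : ℂ :=
  (2 * (Real.pi : ℂ) * Complex.I)⁻¹ * ∮ z in C(0, R), Complex.exp (t * z) * contourRat α β m i j z

section contour

variable {α β : ℕ → ℝ} {R : ℝ} {m i j : ℕ}

theorem sub_ofReal_ne_zero_of_mem_sphere {R b : ℝ} (hb : |b| < R) {z : ℂ}
    (hz : z ∈ Metric.sphere (0 : ℂ) R) : z - (b : ℂ) ≠ 0 := by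
  intro h
  rw [sub_eq_zero] at h
  rw [h] at hz
  simp at hz
  linarith

theorem add_ofReal_ne_zero_of_mem_sphere {R a : ℝ} (ha : |a| < R) {z : ℂ}
    (hz : z ∈ Metric.sphere (0 : ℂ) R) : z + (a : ℂ) ≠ 0 := by
  have := sub_ofReal_ne_zero_of_mem_sphere (b := -a) (by simpa using ha) hz
  simpa using this

theorem continuousOn_contourRat (hα : ∀ k ∈ Finset.Icc 1 m, |α k| < R)
    (hβ : ∀ k ∈ Finset.Icc 1 i, |β k| < R) :
    ContinuousOn (contourRat α β m i j) (Metric.sphere 0 R) := by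
  unfold contourRat
  refine ContinuousOn.mul (ContinuousOn.div (by fun_prop) (by fun_prop) fun z hz => ?_) ?_
  · exact Finset.prod_ne_zero_iff.2 fun k hk => sub_ofReal_ne_zero_of_mem_sphere (hβ k hk) hz
  · refine continuousOn_finsetProd _ fun k hk => ContinuousOn.inv₀ (by fun_prop) fun z hz => ?_
    exact add_ofReal_ne_zero_of_mem_sphere (hα k hk) hz

theorem contourRat_succ_right (z : ℂ) :
    contourRat α β m i (j + 1) z = (z - (β (j + 1) : ℂ)) * contourRat α β m i j z := by
  unfold contourRat
  rw [Finset.prod_Icc_succ_top (by omega)]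
  ring

theorem add_mul_contourRat_succ {z : ℂ} (hz : z + (α (m + 1) : ℂ) ≠ 0) :
    (z + (α (m + 1) : ℂ)) * contourRat α β (m + 1) i j z = contourRat α β m i j z := by
  unfold contourRat
  rw [Finset.prod_Icc_succ_top (by omega)]
  field_simp

/-- Conjugation by `exp (a t)` turns `d/dt` into `d/dt + a`, which multiplies the integrand by `z +
a`. With `a = -β (j + 1)` this adds a factor to the numerator; with `a = α (m + 1)` it removes one
from the denominator. -/
theorem hasDerivAt_exp_mul_contourFun (hR : 0 ≤ R) (hα : ∀ k ∈ Finset.Icc 1 m, |α k| < R)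
    (hβ : ∀ k ∈ Finset.Icc 1 i, |β k| < R) {m' j' : ℕ} (a t : ℝ)
    (h : ∀ z ∈ Metric.sphere (0 : ℂ) R,
      (z + (a : ℂ)) * contourRat α β m i j z = contourRat α β m' i j' z) :
    HasDerivAt (fun t : ℝ => Complex.exp (a * t) * contourFun α β R m i j t)
      (Complex.exp (a * t) * contourFun α β R m' i j' t) t := by
  have hc := continuousOn_contourRat (j := j) hα hβ
  have h1 := (hasDerivAt_circleIntegral_exp_mul hR hc t).const_mul
    ((2 * (Real.pi : ℂ) * Complex.I)⁻¹)
  have h2 : HasDerivAt (fun t : ℝ => Complex.exp (a * t)) (Complex.exp (a * t) * (a * 1)) t :=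
    (((Complex.ofRealCLM.hasDerivAt (x := t)).const_mul (a : ℂ))).cexp
  have h3 := h2.mul h1
  refine h3.congr_deriv ?_
  have h4 : (∮ z in C(0, R), Complex.exp (t * z) * contourRat α β m' i j' z) =
      (∮ z in C(0, R), Complex.exp (t * z) * (z * contourRat α β m i j z)) +
      a * ∮ z in C(0, R), Complex.exp (t * z) * contourRat α β m i j z := by
    rw [← circleIntegral.integral_const_mul, ← circleIntegral.integral_add]
    · refine circleIntegral.integral_congr hR fun z hz => ?_
      simp only [← h z hz]
      ring
    · exact ContinuousOn.circleIntegrable hR (by fun_prop)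
    · exact ContinuousOn.circleIntegrable hR (by fun_prop)
  unfold contourFun
  rw [h4]
  ring

theorem hasDerivAt_exp_mul_contourFun_right (hR : 0 ≤ R) (hα : ∀ k ∈ Finset.Icc 1 m, |α k| < R)
    (hβ : ∀ k ∈ Finset.Icc 1 i, |β k| < R) (t : ℝ) :
    HasDerivAt (fun t : ℝ => Complex.exp ((-β (j + 1) : ℝ) * t) * contourFun α β R m i j t)
      (Complex.exp ((-β (j + 1) : ℝ) * t) * contourFun α β R m i (j + 1) t) t := by
  refine hasDerivAt_exp_mul_contourFun hR hα hβ _ t fun z _ => ?_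
  rw [contourRat_succ_right]
  push_cast
  ring

theorem hasDerivAt_exp_mul_contourFun_succ (hR : 0 ≤ R)
    (hα : ∀ k ∈ Finset.Icc 1 (m + 1), |α k| < R)
    (hβ : ∀ k ∈ Finset.Icc 1 i, |β k| < R) (t : ℝ) :
    HasDerivAt (fun t : ℝ => Complex.exp (α (m + 1) * t) * contourFun α β R (m + 1) i j t)
      (Complex.exp (α (m + 1) * t) * contourFun α β R m i j t) t := by
  refine hasDerivAt_exp_mul_contourFun hR hα hβ _ t fun z hz => ?_
  exact add_mul_contourRat_succ
    (add_ofReal_ne_zero_of_mem_sphere (hα _ (by simp)) hz)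

/-- Under the integral this is `(z + α) - (z - β) = α + β`. -/
theorem contourFun_sub_contourFun (hR : 0 ≤ R)
    (hα : ∀ k ∈ Finset.Icc 1 (m + 1), |α k| < R)
    (hβ : ∀ k ∈ Finset.Icc 1 i, |β k| < R) (t : ℝ) :
    contourFun α β R m i j t - contourFun α β R (m + 1) i (j + 1) t =
      (α (m + 1) + β (j + 1)) * contourFun α β R (m + 1) i j t := by
  have hα' : ∀ k ∈ Finset.Icc 1 m, |α k| < R := fun k hk =>
    hα k (Finset.Icc_subset_Icc_right (Nat.le_succ m) hk)
  have hc := continuousOn_contourRat (j := j) hα' hβ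
  have hc' := continuousOn_contourRat (j := j + 1) hα hβ
  unfold contourFun
  rw [← mul_sub, mul_left_comm, ← circleIntegral.integral_const_mul, ← circleIntegral.integral_sub]
  · congr 1
    refine circleIntegral.integral_congr hR fun z hz => ?_
    have h := add_mul_contourRat_succ (β := β) (i := i) (j := j)
      (add_ofReal_ne_zero_of_mem_sphere (hα (m + 1) (by simp)) hz)
    simp only [← h, contourRat_succ_right]
    ring
  · exact ContinuousOn.circleIntegrable hR (by fun_prop)
  · exact ContinuousOn.circleIntegrable hR (by fun_prop)

theorem prod_Icc_mul_prod_Ioc (f : ℕ → ℂ) (h : j ≤ i) :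
    (∏ k ∈ Finset.Icc 1 j, f k) * ∏ k ∈ Finset.Ioc j i, f k = ∏ k ∈ Finset.Icc 1 i, f k := by
  have : Finset.Icc 1 i = Finset.Icc 1 j ∪ Finset.Ioc j i := by
    ext k; simp only [Finset.mem_Icc, Finset.mem_union, Finset.mem_Ioc]; omega
  rw [this, Finset.prod_union]
  rw [Finset.disjoint_left]
  intro k
  simp only [Finset.mem_Icc, Finset.mem_Ioc]; omega

/-- After cancellation at least two linear factors remain in the denominator and none in the
numerator. The vanishing makes the cut-off at `t = 0` continuous, so that integrating across it
leaves no jump term. -/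
theorem contourFun_zero_eq_zero (hR : 0 < R) (hα : ∀ k ∈ Finset.Icc 1 m, |α k| < R)
    (hβ : ∀ k ∈ Finset.Icc 1 i, |β k| < R) (hj : j ≤ i) (h : j + 2 ≤ i + m) :
    contourFun α β R m i j 0 = 0 := by
  unfold contourFun
  rw [mul_eq_zero]
  right
  refine Eq.trans ?_ (circleIntegral_prod_inv_sub_eq_zero
    ((Finset.Ioc j i).disjSum (Finset.Icc 1 m))
    (Sum.elim (fun k => (β k : ℂ)) fun k => -(α k : ℂ)) hR ?_ ?_)
  · refine circleIntegral.integral_congr hR.le fun z hz => ?_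
    have hne : ∏ k ∈ Finset.Icc 1 j, (z - (β k : ℂ)) ≠ 0 := by
      refine Finset.prod_ne_zero_iff.2 fun k hk => sub_ofReal_ne_zero_of_mem_sphere (hβ k ?_) hz
      exact Finset.Icc_subset_Icc_right hj hk
    simp only [Finset.prod_disjSum, Sum.elim_inl, Sum.elim_inr, sub_neg_eq_add, contourRat]
    rw [← prod_Icc_mul_prod_Ioc _ hj, ← div_div, div_self hne, Finset.prod_inv_distrib]
    simp
  · intro k hk
    rcases Finset.mem_disjSum.1 hk with ⟨l, hl, rfl⟩ | ⟨l, hl, rfl⟩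
    · have := hβ l (by simp only [Finset.mem_Icc, Finset.mem_Ioc] at hl ⊢; omega)
      simpa using this
    · simpa using hα l hl
  · rw [Finset.card_disjSum]
    simp
    omega

/-- For `m = 0` and `i ≤ j` the integrand agrees on the circle with an entire function. -/
theorem contourFun_zero_left_of_le (hR : 0 < R) (hβ : ∀ k ∈ Finset.Icc 1 i, |β k| < R)
    (hj : i ≤ j) (t : ℝ) : contourFun α β R 0 i j t = 0 := by
  unfold contourFun
  rw [mul_eq_zero]
  right
  have h : (∮ z in C(0, R), Complex.exp (t * z) * contourRat α β 0 i j z) =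
      ∮ z in C(0, R), Complex.exp (t * z) * ∏ k ∈ Finset.Ioc i j, (z - (β k : ℂ)) := by
    refine circleIntegral.integral_congr hR.le fun z hz => ?_
    have hne : ∏ k ∈ Finset.Icc 1 i, (z - (β k : ℂ)) ≠ 0 :=
      Finset.prod_ne_zero_iff.2 fun k hk => sub_ofReal_ne_zero_of_mem_sphere (hβ k hk) hz
    simp only [contourRat]
    rw [← prod_Icc_mul_prod_Ioc _ hj, mul_div_cancel_left₀ _ hne]
    simp
  rw [h]
  have hd : Differentiable ℂ fun z : ℂ =>
      Complex.exp (t * z) * ∏ k ∈ Finset.Ioc i j, (z - (β k : ℂ)) := by fun_prop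
  exact Complex.circleIntegral_eq_zero_of_differentiable_on_off_countable hR.le
    Set.countable_empty hd.continuous.continuousOn fun z _ => hd z

theorem two_pi_I_inv_mul_circleIntegral_exp_div {b : ℝ} (hb : |b| < R) (t : ℝ) :
    (2 * (Real.pi : ℂ) * Complex.I)⁻¹ *
      (∮ z in C(0, R), Complex.exp (t * z) * (z - (b : ℂ))⁻¹) = Complex.exp (t * b) := by
  have hd : Differentiable ℂ fun z : ℂ => Complex.exp (t * z) := by fun_prop
  have h := Complex.two_pi_I_inv_smul_circleIntegral_sub_inv_smul_of_differentiable_on_off_countable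
    (R := R) (c := 0) (w := (b : ℂ)) Set.countable_empty (by simpa using hb)
    hd.continuous.continuousOn (fun z _ => hd z)
  simp only [smul_eq_mul] at h
  rw [← h]
  simp only [mul_comm]

theorem contourFun_zero_left_succ (hR : 0 < R) (hβ : ∀ k ∈ Finset.Icc 1 (j + 1), |β k| < R)
    (t : ℝ) : contourFun α β R 0 (j + 1) j t = Complex.exp (t * β (j + 1)) := by
  rw [← two_pi_I_inv_mul_circleIntegral_exp_div (hβ (j + 1) (by simp)) t]
  unfold contourFun
  congr 1
  refine circleIntegral.integral_congr hR.le fun z hz => ?_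
  have hne : ∏ k ∈ Finset.Icc 1 j, (z - (β k : ℂ)) ≠ 0 := by
    refine Finset.prod_ne_zero_iff.2 fun k hk => sub_ofReal_ne_zero_of_mem_sphere (hβ k ?_) hz
    exact Finset.Icc_subset_Icc_right (Nat.le_succ j) hk
  simp only [contourRat]
  rw [Finset.prod_Icc_succ_top (by omega), ← div_div, div_self hne]
  simp

theorem contourFun_one_left_self (hR : 0 < R) (hα : |α 1| < R)
    (hβ : ∀ k ∈ Finset.Icc 1 j, |β k| < R)
    (t : ℝ) : contourFun α β R 1 j j t = Complex.exp (-(α 1 * t)) := by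
  have h := two_pi_I_inv_mul_circleIntegral_exp_div (R := R) (b := -α 1) (by simpa using hα) t
  rw [show Complex.exp (-(α 1 * t)) = Complex.exp (t * ((-α 1 : ℝ) : ℂ)) by
    congr 1; push_cast; ring, ← h]
  unfold contourFun
  congr 1
  refine circleIntegral.integral_congr hR.le fun z hz => ?_
  have hne : ∏ k ∈ Finset.Icc 1 j, (z - (β k : ℂ)) ≠ 0 :=
    Finset.prod_ne_zero_iff.2 fun k hk => sub_ofReal_ne_zero_of_mem_sphere (hβ k hk) hz
  simp only [contourRat]
  rw [div_self hne]
  simp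

theorem continuous_contourFun (hR : 0 ≤ R) (hα : ∀ k ∈ Finset.Icc 1 m, |α k| < R)
    (hβ : ∀ k ∈ Finset.Icc 1 i, |β k| < R) : Continuous (contourFun α β R m i j) := by
  rw [continuous_iff_continuousAt]
  intro t
  exact ((hasDerivAt_circleIntegral_exp_mul hR (continuousOn_contourRat (j := j) hα hβ)
    t).const_mul _).continuousAt

end contour

/-! ### Integration of cut-off kernels along a column -/

theorem intervalIntegrable_ite_le {F : ℝ → ℂ} (hF : Continuous F) (v a b : ℝ) :
    IntervalIntegrable (fun y => if v ≤ y then F y else 0) volume a b := by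
  rw [intervalIntegrable_iff]
  exact (intervalIntegrable_iff.1 (hF.intervalIntegrable a b)).indicator measurableSet_Ici

/-- The fundamental theorem of calculus survives the cut-off at `v` if `v` is not to the right of
`a`, or if the primitive does not jump there. -/
theorem integral_ite_le_eq_sub {F F' : ℝ → ℂ} (hF : ∀ t, HasDerivAt F (F' t) t)
    (hF' : Continuous F') {v a b : ℝ} (hab : a ≤ b) (hv : v ≤ a ∨ F v = 0) :
    ∫ y in a..b, (if v ≤ y then F' y else 0) =
      (if v ≤ b then F b else 0) - (if v ≤ a then F a else 0) := by
  have hFTC : ∀ c d : ℝ, v ≤ c → c ≤ d →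
      ∫ y in c..d, (if v ≤ y then F' y else 0) = F d - F c := by
    intro c d hc hcd
    rw [← intervalIntegral.integral_eq_sub_of_hasDerivAt (fun t _ => hF t)
      (hF'.intervalIntegrable c d)]
    refine intervalIntegral.integral_congr fun y hy => ?_
    rw [Set.uIcc_of_le hcd] at hy
    simp [hc.trans hy.1]
  have hzero : ∀ c : ℝ, a ≤ c → c ≤ v → ∫ y in a..c, (if v ≤ y then F' y else 0) = 0 := by
    intro c hac hcv
    rw [intervalIntegral.integral_of_le hac, integral_Ioc_eq_integral_Ioo,
      setIntegral_congr_fun (g := fun _ => 0) measurableSet_Ioo fun y hy => ?_]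
    · simp
    · simp [(hy.2.trans_le hcv).not_ge]
  by_cases hva : v ≤ a
  · rw [hFTC a b hva hab, if_pos (hva.trans hab), if_pos hva]
  · have hv0 : F v = 0 := hv.resolve_left hva
    push Not at hva
    rw [if_neg hva.not_ge, sub_zero]
    by_cases hvb : v ≤ b
    · rw [if_pos hvb, ← intervalIntegral.integral_add_adjacent_intervals
        (intervalIntegrable_ite_le hF' v a v) (intervalIntegrable_ite_le hF' v v b),
        hzero v hva.le le_rfl, hFTC v b le_rfl hvb, hv0]
      simp
    · rw [if_neg hvb, hzero b hab (not_le.1 hvb).le]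

/-- The contour integral, cut off at negative times. -/
noncomputable def causalFun (α β : ℕ → ℝ) (R : ℝ) (m i j : ℕ) (t : ℝ) : ℂ :=
  if 0 ≤ t then contourFun α β R m i j t else 0

theorem integral_exp_mul_ite {F F' : ℝ → ℂ} {s : ℝ}
    (hF : ∀ t : ℝ, HasDerivAt (fun t : ℝ => Complex.exp (s * t) * F t)
      (Complex.exp (s * t) * F' t) t)
    (hF' : Continuous F') {v a b : ℝ} (hab : a ≤ b) (hv : v ≤ a ∨ F 0 = 0) :
    ∫ y in a..b, Complex.exp (s * y) * (if 0 ≤ y - v then F' (y - v) else 0) =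
      Complex.exp (s * b) * (if 0 ≤ b - v then F (b - v) else 0) -
      Complex.exp (s * a) * (if 0 ≤ a - v then F (a - v) else 0) := by
  have hd : ∀ t : ℝ, HasDerivAt (fun y : ℝ => Complex.exp (s * y) * F (y - v))
      (Complex.exp (s * t) * F' (t - v)) t := by
    intro t
    have h1 := ((hF (t - v)).comp_sub_const t v).const_mul (Complex.exp (s * v))
    have he : ∀ y : ℝ, Complex.exp (s * v) * Complex.exp (s * ((y - v : ℝ) : ℂ)) =
        Complex.exp (s * y) := by
      intro y
      rw [← Complex.exp_add]
      congr 1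
      push_cast
      ring
    simpa only [← mul_assoc, he] using h1
  have := integral_ite_le_eq_sub hd (by fun_prop) hab
    (hv.imp id fun h => by simp [h])
  simpa only [sub_nonneg, mul_ite, mul_zero] using this

section column

variable {α β : ℕ → ℝ} {R : ℝ} {m i j : ℕ}

theorem integral_exp_mul_causalFun_right (hR : 0 < R) (hα : ∀ k ∈ Finset.Icc 1 m, |α k| < R)
    (hβ : ∀ k ∈ Finset.Icc 1 i, |β k| < R) {v a b : ℝ} (hab : a ≤ b)
    (hv : v ≤ a ∨ (j ≤ i ∧ j + 2 ≤ i + m)) :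
    ∫ y in a..b, Complex.exp ((-β (j + 1) : ℝ) * y) * causalFun α β R m i (j + 1) (y - v) =
      Complex.exp ((-β (j + 1) : ℝ) * b) * causalFun α β R m i j (b - v) -
      Complex.exp ((-β (j + 1) : ℝ) * a) * causalFun α β R m i j (a - v) :=
  integral_exp_mul_ite (fun t => hasDerivAt_exp_mul_contourFun_right hR.le hα hβ t)
    (continuous_contourFun hR.le hα hβ) hab
    (hv.imp id fun h => contourFun_zero_eq_zero hR hα hβ h.1 h.2)

theorem integral_exp_mul_causalFun_succ (hR : 0 < R)
    (hα : ∀ k ∈ Finset.Icc 1 (m + 1), |α k| < R)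
    (hβ : ∀ k ∈ Finset.Icc 1 i, |β k| < R) {v a b : ℝ} (hab : a ≤ b)
    (hv : v ≤ a ∨ (j ≤ i ∧ j + 1 ≤ i + m)) :
    ∫ y in a..b, Complex.exp (α (m + 1) * y) * causalFun α β R m i j (y - v) =
      Complex.exp (α (m + 1) * b) * causalFun α β R (m + 1) i j (b - v) -
      Complex.exp (α (m + 1) * a) * causalFun α β R (m + 1) i j (a - v) :=
  integral_exp_mul_ite (fun t => hasDerivAt_exp_mul_contourFun_succ hR.le hα hβ t)
    (continuous_contourFun hR.le
      (fun k hk => hα k (Finset.Icc_subset_Icc_right (Nat.le_succ m) hk)) hβ) hab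
    (hv.imp id fun h => contourFun_zero_eq_zero hR hα hβ h.1 (by omega))

theorem causalFun_sub_causalFun (hR : 0 ≤ R)
    (hα : ∀ k ∈ Finset.Icc 1 (m + 1), |α k| < R)
    (hβ : ∀ k ∈ Finset.Icc 1 i, |β k| < R) (t : ℝ) :
    causalFun α β R m i j t - causalFun α β R (m + 1) i (j + 1) t =
      (α (m + 1) + β (j + 1)) * causalFun α β R (m + 1) i j t := by
  unfold causalFun
  split_ifs
  · exact contourFun_sub_contourFun hR hα hβ t
  · simp

theorem causalFun_of_neg {t : ℝ} (ht : t < 0) : causalFun α β R m i j t = 0 :=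
  if_neg ht.not_ge

theorem intervalIntegrable_mul_causalFun (hR : 0 ≤ R) (hα : ∀ k ∈ Finset.Icc 1 m, |α k| < R)
    (hβ : ∀ k ∈ Finset.Icc 1 i, |β k| < R) {g : ℝ → ℂ} (hg : Continuous g) (v a b : ℝ) :
    IntervalIntegrable (fun y => g y * causalFun α β R m i j (y - v)) volume a b := by
  have hc := continuous_contourFun (j := j) hR hα hβ
  have := intervalIntegrable_ite_le (F := fun y => g y * contourFun α β R m i j (y - v))
    (by fun_prop) v a b
  refine this.congr fun y _ => ?_
  simp [causalFun, sub_nonneg]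

/-- The weight which the one-step transition density to `z` gives to the coordinate `y_j`. -/
noncomputable def stepWeight (a b c y : ℝ) : ℂ :=
  Complex.exp ((-b : ℝ) * y) * Complex.exp ((a + b : ℝ) * (max y c : ℝ))

theorem continuous_stepWeight (a b c : ℝ) : Continuous (stepWeight a b c) := by
  unfold stepWeight
  fun_prop

/-- The weight is a constant times `exp (-β y)` on `[a, c]` and equals `exp (α y)` on `[c, b]`; on
the first piece lowering `j` gives a primitive, on the second raising `m`. The two boundary terms at
`c` combine through `causalFun_sub_causalFun`. With `j + 1 ≤ i`, the hypothesis `1 ≤ m` supplies the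
second factor of decay that makes the first primitive vanish at the cut-off. -/
theorem integral_stepWeight_mul_causalFun (hR : 0 < R)
    (hα : ∀ k ∈ Finset.Icc 1 (m + 1), |α k| < R)
    (hβ : ∀ k ∈ Finset.Icc 1 i, |β k| < R) {v a b c : ℝ} (hac : a ≤ c) (hcb : c ≤ b)
    (hm : 1 ≤ m) (hv : v ≤ a ∨ j + 1 ≤ i) :
    ∫ y in a..b, stepWeight (α (m + 1)) (β (j + 1)) c y * causalFun α β R m i (j + 1) (y - v) =
      Complex.exp (α (m + 1) * b) * causalFun α β R (m + 1) i (j + 1) (b - v) +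
      (α (m + 1) + β (j + 1)) *
        (Complex.exp (α (m + 1) * c) * causalFun α β R (m + 1) i j (c - v)) -
      Complex.exp ((α (m + 1) + β (j + 1) : ℝ) * c + (-β (j + 1) : ℝ) * a) *
        causalFun α β R m i j (a - v) := by
  have hα' : ∀ k ∈ Finset.Icc 1 m, |α k| < R := fun k hk =>
    hα k (Finset.Icc_subset_Icc_right (Nat.le_succ m) hk)
  have hint := fun p q => intervalIntegrable_mul_causalFun (j := j + 1) hR.le hα' hβ
    (continuous_stepWeight (α (m + 1)) (β (j + 1)) c) v p q
  rw [← intervalIntegral.integral_add_adjacent_intervals (hint a c) (hint c b)]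
  have h1 : ∫ y in a..c, stepWeight (α (m + 1)) (β (j + 1)) c y *
        causalFun α β R m i (j + 1) (y - v) =
      Complex.exp ((α (m + 1) + β (j + 1) : ℝ) * c) * ∫ y in a..c,
        Complex.exp ((-β (j + 1) : ℝ) * y) * causalFun α β R m i (j + 1) (y - v) := by
    rw [← intervalIntegral.integral_const_mul]
    refine intervalIntegral.integral_congr fun y hy => ?_
    rw [Set.uIcc_of_le hac] at hy
    simp only [stepWeight, max_eq_right hy.2]
    ring
  have h2 : ∫ y in c..b, stepWeight (α (m + 1)) (β (j + 1)) c y *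
        causalFun α β R m i (j + 1) (y - v) =
      ∫ y in c..b, Complex.exp (α (m + 1) * y) * causalFun α β R m i (j + 1) (y - v) := by
    refine intervalIntegral.integral_congr fun y hy => ?_
    rw [Set.uIcc_of_le hcb] at hy
    simp only [stepWeight, max_eq_left hy.1, ← Complex.exp_add]
    congr 2
    push_cast
    ring
  rw [h1, h2, integral_exp_mul_causalFun_right hR hα' hβ hac (hv.imp id fun h => by omega),
    integral_exp_mul_causalFun_succ hR hα hβ hcb
      (hv.imp (fun h => h.trans hac) fun h => by omega)]
  have h3 := causalFun_sub_causalFun (j := j) hR.le hα hβ (c - v)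
  have h4 : Complex.exp ((α (m + 1) + β (j + 1) : ℝ) * c) *
      Complex.exp ((-β (j + 1) : ℝ) * c) = Complex.exp (α (m + 1) * c) := by
    rw [← Complex.exp_add]
    congr 1
    push_cast
    ring
  rw [Complex.exp_add, mul_left_comm, ← h3, ← h4]
  ring

end column

/-! ### Determinants with blocks of zeros -/

section det

variable {N : ℕ}

/-- Pigeonhole: the `n + 1` indices up to `n` cannot be mapped injectively into the `n` indices
below `n`. -/
theorem Equiv.Perm.exists_le_of_map_lt (σ : Equiv.Perm (Fin N)) (n : Fin N) :
    ∃ k ≤ n, n ≤ σ k := by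
  by_contra! h
  have hmaps : Set.MapsTo σ (Finset.Iic n : Finset (Fin N)) (Finset.Iio n : Finset (Fin N)) := by
    intro k hk
    simpa using h k (by simpa using hk)
  have := Finset.card_le_card_of_injOn σ hmaps σ.injective.injOn
  simp at this

theorem Matrix.det_eq_zero_of_lower_left_block {A : Matrix (Fin N) (Fin N) ℂ} (n : Fin N)
    (h : ∀ i k, k ≤ n → n ≤ i → A i k = 0) : A.det = 0 := by
  rw [Matrix.det_apply]
  refine Finset.sum_eq_zero fun σ _ => ?_
  obtain ⟨k, hk, hnk⟩ := σ.exists_le_of_map_lt n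
  have hprod : ∏ i, A (σ i) i = 0 := Finset.prod_eq_zero (Finset.mem_univ k) (h _ _ hk hnk)
  exact (congrArg _ hprod).trans (smul_zero _)

/-- Every non-zero entry above the diagonal is accompanied by a zero block that no permutation using
this entry can avoid. The entries above the diagonal may therefore be replaced by zero. -/
theorem Matrix.det_eq_prod_diag_of_forall_block {A : Matrix (Fin N) (Fin N) ℂ}
    (h : ∀ i n, i < n → A i n ≠ 0 → ∀ i' k, k < n → n ≤ i' → A i' k = 0) :
    A.det = ∏ i, A i i := by
  have hdet : A.det = (Matrix.of fun i j => if i < j then 0 else A i j).det := by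
    rw [Matrix.det_apply, Matrix.det_apply]
    refine Finset.sum_congr rfl fun σ _ => ?_
    congr 1
    by_cases hσ : ∃ n, σ n < n
    · obtain ⟨n, hn⟩ := hσ
      trans 0
      · by_cases hA : A (σ n) n = 0
        · exact Finset.prod_eq_zero (Finset.mem_univ n) hA
        · obtain ⟨k, hk, hnk⟩ := σ.exists_le_of_map_lt n
          have hkn : k < n := lt_of_le_of_ne hk fun h => by
            rw [h] at hnk
            exact absurd hn hnk.not_gt
          exact Finset.prod_eq_zero (Finset.mem_univ k) (h _ _ hn hA _ _ hkn hnk)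
      · exact (Finset.prod_eq_zero (Finset.mem_univ n) (by simp [hn])).symm
    · push Not at hσ
      exact Finset.prod_congr rfl fun k _ => by simp [(hσ k).not_gt]
  rw [hdet, Matrix.det_of_isLowerTriangular]
  · simp
  · intro i j hij
    simp only [Matrix.of_apply]
    exact if_pos hij

end det

/-! ### Splitting off the last coordinate; vectors with a boundary value -/

section snoc

variable {n : ℕ}

theorem MeasurableEquiv.piFinSuccAbove_last_symm_apply (p : ℝ × (Fin n → ℝ)) :
    (MeasurableEquiv.piFinSuccAbove (fun _ : Fin (n + 1) => ℝ) (Fin.last n)).symm p =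
      Fin.snoc (α := fun _ => ℝ) p.2 p.1 :=
  Fin.insertNth_last' p.1 p.2

theorem integral_eq_integral_integral_snoc {G : (Fin (n + 1) → ℝ) → ℂ} (hG : Integrable G) :
    ∫ y, G y = ∫ y : Fin n → ℝ, ∫ t : ℝ, G (Fin.snoc (α := fun _ => ℝ) y t) := by
  have he := (volume_preserving_piFinSuccAbove (fun _ : Fin (n + 1) => ℝ) (Fin.last n)).symm
  rw [← he.integral_comp', Measure.volume_eq_prod, integral_prod_symm]
  · simp only [MeasurableEquiv.piFinSuccAbove_last_symm_apply]
  · exact (he.integrable_comp_emb (MeasurableEquiv.measurableEmbedding _)).2 hG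

theorem lintegral_eq_lintegral_lintegral_snoc {G : (Fin (n + 1) → ℝ) → ENNReal}
    (hG : Measurable G) :
    ∫⁻ y, G y = ∫⁻ y : Fin n → ℝ, ∫⁻ t : ℝ, G (Fin.snoc (α := fun _ => ℝ) y t) := by
  have he := (volume_preserving_piFinSuccAbove (fun _ : Fin (n + 1) => ℝ) (Fin.last n)).symm
  rw [← he.lintegral_comp hG, Measure.volume_eq_prod, lintegral_prod_symm]
  · simp only [MeasurableEquiv.piFinSuccAbove_last_symm_apply]
  · exact (hG.comp he.measurable).aemeasurable

end snoc

/-- A vector with coordinates numbered from `1`, extended to all indices by the constant `L`. -/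
def extendFin (L : ℝ) {n : ℕ} (y : Fin n → ℝ) : ℕ → ℝ
  | 0 => L
  | k + 1 => if h : k < n then y ⟨k, h⟩ else L

section extendFin

variable {L : ℝ} {n : ℕ}

theorem extendFin_zero (y : Fin n → ℝ) : extendFin L y 0 = L := rfl

theorem extendFin_succ (y : Fin n → ℝ) {k : ℕ} (h : k < n) :
    extendFin L y (k + 1) = y ⟨k, h⟩ := dif_pos h

theorem extendFin_val_succ (y : Fin n → ℝ) (k : Fin n) :
    extendFin L y ((k : ℕ) + 1) = y k := dif_pos k.2

theorem extendFin_snoc_of_le (y : Fin n → ℝ) (t : ℝ) {k : ℕ} (h : k ≤ n) :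
    extendFin L (Fin.snoc (α := fun _ => ℝ) y t : Fin (n + 1) → ℝ) k = extendFin L y k := by
  cases k with
  | zero => rfl
  | succ k =>
    rw [extendFin_succ _ (by omega : k < n + 1), extendFin_succ _ (by omega : k < n)]
    exact Fin.snoc_castSucc (α := fun _ => ℝ) t y ⟨k, by omega⟩

theorem extendFin_snoc_last (y : Fin n → ℝ) (t : ℝ) :
    extendFin L (Fin.snoc (α := fun _ => ℝ) y t : Fin (n + 1) → ℝ) (n + 1) = t := by
  rw [extendFin_succ _ (by omega : n < n + 1)]
  exact Fin.snoc_last (α := fun _ => ℝ) t y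

theorem measurable_extendFin (k : ℕ) : Measurable fun y : Fin n → ℝ => extendFin L y k := by
  cases k with
  | zero => exact measurable_const
  | succ k =>
    by_cases h : k < n
    · simp only [extendFin_succ _ h]
      exact measurable_pi_apply _
    · simp only [extendFin, dif_neg h]
      exact measurable_const

/-- The vectors `L ≤ y₁ ≤ ⋯ ≤ y_n` with `y_k ≤ z_k` for all `k`. -/
def interlacingBox (L : ℝ) (z : ℕ → ℝ) (n : ℕ) : Set (Fin n → ℝ) :=
  {y | ∀ k : Fin n, extendFin L y k ≤ extendFin L y (k + 1) ∧ extendFin L y (k + 1) ≤ z (k + 1)}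

variable {z : ℕ → ℝ}

theorem measurableSet_interlacingBox : MeasurableSet (interlacingBox L z n) := by
  rw [interlacingBox, Set.ofPred_forall]
  exact MeasurableSet.iInter fun k =>
    (measurableSet_le (measurable_extendFin _) (measurable_extendFin _)).inter
      (measurableSet_le (measurable_extendFin _) measurable_const)

theorem extendFin_mono_of_mem {y : Fin n → ℝ} (hy : y ∈ interlacingBox L z n) {k l : ℕ}
    (hkl : k ≤ l) (hl : l ≤ n) : extendFin L y k ≤ extendFin L y l := by
  induction l, hkl using Nat.le_induction with
  | base => exact le_rfl
  | succ l hkl ih => exact (ih (by omega)).trans (hy ⟨l, by omega⟩).1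

theorem snoc_mem_interlacingBox {y : Fin n → ℝ} {t : ℝ} :
    (Fin.snoc (α := fun _ => ℝ) y t : Fin (n + 1) → ℝ) ∈ interlacingBox L z (n + 1) ↔
      y ∈ interlacingBox L z n ∧ extendFin L y n ≤ t ∧ t ≤ z (n + 1) := by
  constructor
  · intro h
    refine ⟨fun k => ?_, ?_⟩
    · have := h k.castSucc
      rwa [Fin.val_castSucc, extendFin_snoc_of_le _ _ (by omega),
        extendFin_snoc_of_le _ _ (by omega)] at this
    · have := h (Fin.last n)
      rwa [Fin.val_last, extendFin_snoc_of_le _ _ le_rfl, extendFin_snoc_last] at this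
  · rintro ⟨h, h'⟩ k
    induction k using Fin.lastCases with
    | last => rwa [Fin.val_last, extendFin_snoc_of_le _ _ le_rfl, extendFin_snoc_last]
    | cast k =>
      rw [Fin.val_castSucc, extendFin_snoc_of_le _ _ (by omega),
        extendFin_snoc_of_le _ _ (by omega)]
      exact h k

theorem interlacingBox_subset_Icc :
    interlacingBox L z n ⊆ Set.Icc (fun _ => L) fun k => z (k + 1) := by
  intro y hy
  refine ⟨fun k => ?_, fun k => ?_⟩
  · have := extendFin_mono_of_mem hy (Nat.zero_le ((k : ℕ) + 1)) (by omega)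
    rwa [extendFin_val_succ] at this
  · have := (hy k).2
    rwa [extendFin_val_succ] at this

end extendFin

/-! ### The convolution of the determinant with one step -/

/-- An entry of the `m`-step determinant times the weight from the one-step density. -/
noncomputable def stepCol (α β : ℕ → ℝ) (R : ℝ) (m : ℕ) (x z : ℕ → ℝ) (i j : ℕ) (y : ℝ) : ℂ :=
  stepWeight (α (m + 1)) (β (j + 1)) (z j) y * causalFun α β R m i (j + 1) (y - x i)

/-- The result of integrating `stepCol`, up to terms that do not contribute to the determinant. -/
noncomputable def stepImage (α β : ℕ → ℝ) (R : ℝ) (m : ℕ) (x z : ℕ → ℝ) (i j : ℕ) : ℂ :=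
  Complex.exp (α (m + 1) * z (j + 1)) * causalFun α β R (m + 1) i (j + 1) (z (j + 1) - x i) +
    (α (m + 1) + β (j + 1)) *
      (Complex.exp (α (m + 1) * z j) * causalFun α β R (m + 1) i j (z j - x i))

/-- The matrix in which the columns from the `n`-th on have been integrated. -/
noncomputable def partialMatrix (α β : ℕ → ℝ) (R : ℝ) (m N : ℕ) (x z : ℕ → ℝ) (n : ℕ)
    (y : Fin n → ℝ) : Matrix (Fin N) (Fin N) ℂ :=
  Matrix.of fun i j => if h : (j : ℕ) < n then stepCol α β R m x z (i + 1) j (y ⟨j, h⟩)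
    else stepImage α β R m x z (i + 1) j

section step

variable {α β : ℕ → ℝ} {R : ℝ} {m N n : ℕ} {x z : ℕ → ℝ} {L : ℝ}

theorem measurable_causalFun {i j : ℕ} (hR : 0 ≤ R) (hα : ∀ k ∈ Finset.Icc 1 m, |α k| < R)
    (hβ : ∀ k ∈ Finset.Icc 1 i, |β k| < R) : Measurable (causalFun α β R m i j) := by
  unfold causalFun
  exact Measurable.ite measurableSet_Ici (continuous_contourFun hR hα hβ).measurable
    measurable_const

theorem exists_norm_causalFun_le {i j : ℕ} (hR : 0 ≤ R) (hα : ∀ k ∈ Finset.Icc 1 m, |α k| < R)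
    (hβ : ∀ k ∈ Finset.Icc 1 i, |β k| < R) (a b : ℝ) :
    ∃ K, ∀ t ∈ Set.Icc a b, ‖causalFun α β R m i j t‖ ≤ K := by
  obtain ⟨K, hK⟩ := (isCompact_Icc (a := a) (b := b)).exists_bound_of_continuousOn
    (continuous_contourFun (j := j) hR hα hβ).continuousOn
  refine ⟨K, fun t ht => ?_⟩
  unfold causalFun
  split_ifs
  · exact hK t ht
  · simpa using (norm_nonneg _).trans (hK t ht)

theorem measurable_stepCol {i j : ℕ} (hR : 0 ≤ R) (hα : ∀ k ∈ Finset.Icc 1 m, |α k| < R)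
    (hβ : ∀ k ∈ Finset.Icc 1 i, |β k| < R) : Measurable (stepCol α β R m x z i j) := by
  unfold stepCol
  exact (continuous_stepWeight _ _ _).measurable.mul
    ((measurable_causalFun hR hα hβ).comp (measurable_id.sub_const _))

theorem exists_norm_stepCol_le {i j : ℕ} (hR : 0 ≤ R) (hα : ∀ k ∈ Finset.Icc 1 m, |α k| < R)
    (hβ : ∀ k ∈ Finset.Icc 1 i, |β k| < R) (a b : ℝ) :
    ∃ K, ∀ t ∈ Set.Icc a b, ‖stepCol α β R m x z i j t‖ ≤ K := by
  obtain ⟨K, hK⟩ := exists_norm_causalFun_le (j := j + 1) hR hα hβ (a - x i) (b - x i)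
  obtain ⟨K', hK'⟩ := (isCompact_Icc (a := a) (b := b)).exists_bound_of_continuousOn
    (continuous_stepWeight (α (m + 1)) (β (j + 1)) (z j)).continuousOn
  refine ⟨K' * K, fun t ht => ?_⟩
  rw [stepCol, norm_mul]
  exact mul_le_mul (hK' t ht) (hK _ ⟨by linarith [ht.1], by linarith [ht.2]⟩) (norm_nonneg _)
    ((norm_nonneg _).trans (hK' t ht))

theorem measurable_det_of_measurable {Y : Type*} [MeasurableSpace Y]
    {A : Y → Matrix (Fin N) (Fin N) ℂ} (hA : ∀ i j, Measurable fun y => A y i j) :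
    Measurable fun y => (A y).det := by
  simp only [Matrix.det_apply']
  exact Finset.measurable_fun_sum _ fun σ _ =>
    (Finset.measurable_fun_prod _ fun i _ => hA _ _).const_mul _

theorem norm_det_le_of_norm_le {A : Matrix (Fin N) (Fin N) ℂ} {K : ℝ} (hK : ∀ i j, ‖A i j‖ ≤ K) :
    ‖A.det‖ ≤ N.factorial * K ^ N := by
  have := Matrix.det_le (abv := NormedField.toAbsoluteValue ℂ) (A := A) (x := K) hK
  rw [Fintype.card_fin, nsmul_eq_mul] at this
  exact this

theorem measurable_det_partialMatrix (hR : 0 ≤ R) (hα : ∀ k ∈ Finset.Icc 1 m, |α k| < R)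
    (hβ : ∀ k ∈ Finset.Icc 1 N, |β k| < R) :
    Measurable fun y => (partialMatrix α β R m N x z n y).det := by
  refine measurable_det_of_measurable fun i j => ?_
  simp only [partialMatrix, Matrix.of_apply]
  by_cases h : (j : ℕ) < n
  · simp only [dif_pos h]
    exact (measurable_stepCol hR hα fun k hk =>
      hβ k (Finset.Icc_subset_Icc_right (by omega) hk)).comp (measurable_pi_apply _)
  · simp only [dif_neg h]
    exact measurable_const

theorem exists_norm_det_partialMatrix_le (hR : 0 ≤ R) (hα : ∀ k ∈ Finset.Icc 1 m, |α k| < R)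
    (hβ : ∀ k ∈ Finset.Icc 1 N, |β k| < R) :
    ∃ K, ∀ y ∈ interlacingBox L z n, ‖(partialMatrix α β R m N x z n y).det‖ ≤ K := by
  have h : ∀ i j : Fin N, ∃ K, ∀ y ∈ interlacingBox L z n,
      ‖partialMatrix α β R m N x z n y i j‖ ≤ K := by
    intro i j
    simp only [partialMatrix, Matrix.of_apply]
    by_cases h : (j : ℕ) < n
    · obtain ⟨K, hK⟩ := exists_norm_stepCol_le (i := i + 1) (j := j) (x := x) (z := z) hR hα
        (fun k hk => hβ k (Finset.Icc_subset_Icc_right (by omega) hk)) L (z (j + 1))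
      refine ⟨K, fun y hy => ?_⟩
      rw [dif_pos h]
      have := interlacingBox_subset_Icc hy
      exact hK _ ⟨this.1 _, this.2 ⟨j, h⟩⟩
    · exact ⟨_, fun y hy => by rw [dif_neg h]⟩
  choose K hK using h
  obtain ⟨B, hB⟩ := (Set.finite_range fun p : Fin N × Fin N => K p.1 p.2).bddAbove
  exact ⟨_, fun y hy => norm_det_le_of_norm_le (K := B) fun i j =>
    (hK i j y hy).trans (hB ⟨(i, j), rfl⟩)⟩

theorem integrable_indicator_det_partialMatrix (hR : 0 ≤ R)
    (hα : ∀ k ∈ Finset.Icc 1 m, |α k| < R) (hβ : ∀ k ∈ Finset.Icc 1 N, |β k| < R) :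
    Integrable ((interlacingBox L z n).indicator fun y =>
      (partialMatrix α β R m N x z n y).det) := by
  rw [integrable_indicator_iff measurableSet_interlacingBox]
  obtain ⟨K, hK⟩ := exists_norm_det_partialMatrix_le (x := x) (z := z) (n := n) (L := L) hR hα hβ
  refine Measure.integrableOn_of_bounded (M := K) ?_
    (measurable_det_partialMatrix hR hα hβ).aestronglyMeasurable ?_
  · exact ((measure_mono interlacingBox_subset_Icc).trans_lt isCompact_Icc.measure_lt_top).ne
  · exact (ae_restrict_iff' measurableSet_interlacingBox).2 (Filter.Eventually.of_forall hK)

theorem intervalIntegrable_stepCol {i j : ℕ} (hR : 0 ≤ R) (hα : ∀ k ∈ Finset.Icc 1 m, |α k| < R)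
    (hβ : ∀ k ∈ Finset.Icc 1 i, |β k| < R) (a b : ℝ) :
    IntervalIntegrable (stepCol α β R m x z i j) volume a b :=
  intervalIntegrable_mul_causalFun hR hα hβ (continuous_stepWeight _ _ _) _ _ _

/-- The determinant is linear in one column, with cofactors that do not depend on `t`. -/
theorem integral_det_updateCol (A : Matrix (Fin N) (Fin N) ℂ) (j : Fin N) {f : Fin N → ℝ → ℂ}
    {a b : ℝ} (hf : ∀ i, IntervalIntegrable (f i) volume a b) :
    ∫ t in a..b, (A.updateCol j fun i => f i t).det =
      (A.updateCol j fun i => ∫ t in a..b, f i t).det := by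
  simp only [← Matrix.cramer_apply]
  have h : ∀ v : Fin N → ℂ, A.cramer v j = ∑ i, A.adjugate j i * v i := fun v => by
    rw [Matrix.cramer_eq_adjugate_mulVec]
    rfl
  simp only [h]
  rw [intervalIntegral.integral_finsetSum fun i _ => (hf i).const_mul _]
  simp only [intervalIntegral.integral_const_mul]

end step

section step

variable {α β : ℕ → ℝ} {R : ℝ} {m N n : ℕ} {x z : ℕ → ℝ} {L : ℝ}

theorem partialMatrix_snoc (hn : n < N) (y : Fin n → ℝ) (t : ℝ) :
    partialMatrix α β R m N x z (n + 1) (Fin.snoc (α := fun _ => ℝ) y t) =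
      (partialMatrix α β R m N x z n y).updateCol ⟨n, hn⟩
        fun i => stepCol α β R m x z (i + 1) n t := by
  ext i j
  rw [Matrix.updateCol_apply]
  simp only [partialMatrix, Matrix.of_apply]
  rcases lt_trichotomy (j : ℕ) n with h | h | h
  · rw [dif_pos (by omega), if_neg (by rintro rfl; simp at h), dif_pos h]
    congr 1
    exact Fin.snoc_castSucc (α := fun _ => ℝ) t y ⟨j, h⟩
  · obtain rfl : j = ⟨n, hn⟩ := Fin.ext h
    rw [dif_pos (by simp), if_pos rfl]
    congr 1
    exact Fin.snoc_last (α := fun _ => ℝ) t y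
  · rw [dif_neg (by omega), if_neg (by rintro rfl; simp at h), dif_neg (by omega)]

/-- The integrated column `v` is the column of `stepImage`, minus the boundary term `w` at the lower
limit, plus an error in those rows where the closed form of the integral is not available. By
linearity in the column it is enough that `w` and the error each give determinant zero. -/
theorem det_updateCol_integral_stepCol (hR : 0 < R) (hα : ∀ k ∈ Finset.Icc 1 (m + 1), |α k| < R)
    (hβ : ∀ k ∈ Finset.Icc 1 N, |β k| < R) (hm : 1 ≤ m)
    (hx : ∀ i j, 1 ≤ i → i ≤ j → j ≤ N → x i ≤ x j) (hL : L < x 1)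
    (hn : n < N) {y : Fin n → ℝ} (hy : y ∈ interlacingBox L z n)
    (hyz : extendFin L y n ≤ z n) (hz : z n ≤ z (n + 1)) :
    ((partialMatrix α β R m N x z n y).updateCol ⟨n, hn⟩ fun i =>
      ∫ t in (extendFin L y n)..(z (n + 1)), stepCol α β R m x z (i + 1) n t).det =
      (partialMatrix α β R m N x z n y).det := by
  set A := partialMatrix α β R m N x z n y with hA
  set a := extendFin L y n with ha
  set v : Fin N → ℂ := fun i => ∫ t in a..(z (n + 1)), stepCol α β R m x z (i + 1) n t with hv
  set w : Fin N → ℂ := fun i =>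
    Complex.exp ((α (m + 1) + β (n + 1) : ℝ) * z n + (-β (n + 1) : ℝ) * a) *
      causalFun α β R m (i + 1) n (a - x (i + 1)) with hw
  have hAn : ∀ i, A i ⟨n, hn⟩ = stepImage α β R m x z (i + 1) n := fun i => by
    simp [hA, partialMatrix]
  have hAlt : ∀ i (k : Fin N) (hk : (k : ℕ) < n),
      A i k = stepCol α β R m x z (i + 1) k (y ⟨k, hk⟩) := fun i k hk => by
    simp [hA, partialMatrix, hk]
  have hvw : ∀ i : Fin N, x (i + 1) ≤ a ∨ n ≤ i → v i = A i ⟨n, hn⟩ - w i := by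
    intro i hi
    rw [hAn]
    exact integral_stepWeight_mul_causalFun hR hα
      (fun k hk => hβ k (Finset.Icc_subset_Icc_right (by omega) hk)) hyz hz hm
      (hi.imp id fun h => by omega)
  have hsplit : v = (fun i => A i ⟨n, hn⟩) + (fun i => v i - A i ⟨n, hn⟩ + w i) - w := by
    ext i
    simp only [Pi.sub_apply, Pi.add_apply]
    ring
  -- For the first column `a = L < x 1`, so `w` vanishes; later `a` is the preceding coordinate of
  -- `y` and `w` is a multiple of the preceding column.
  have hdetw : (A.updateCol ⟨n, hn⟩ w).det = 0 := by
    cases n with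
    | zero =>
      refine Matrix.det_eq_zero_of_column_eq_zero ⟨0, hn⟩ fun i => ?_
      rw [Matrix.updateCol_self, hw]
      simp only
      rw [causalFun_of_neg, mul_zero]
      have := hx 1 (i + 1) le_rfl (by omega) (by omega)
      rw [ha, extendFin_zero]
      linarith
    | succ n =>
      have hwe : w = (Complex.exp ((α (m + 1) + β (n + 1 + 1) : ℝ) * z (n + 1) +
          (-β (n + 1 + 1) : ℝ) * a) / stepWeight (α (m + 1)) (β (n + 1)) (z n) a) •
          fun i => A i ⟨n, by omega⟩ := by
        ext i
        have hne : stepWeight (α (m + 1)) (β (n + 1)) (z n) a ≠ 0 :=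
          mul_ne_zero (Complex.exp_ne_zero _) (Complex.exp_ne_zero _)
        have hay : y ⟨n, by omega⟩ = a := by rw [ha, extendFin_succ]
        rw [Pi.smul_apply, hAlt i ⟨n, by omega⟩ (by simp)]
        simp only [hw, stepCol, hay, smul_eq_mul]
        field_simp
      have hne : (⟨n + 1, hn⟩ : Fin N) ≠ ⟨n, by omega⟩ := by simp
      rw [hwe, Matrix.det_updateCol_smul, Matrix.det_zero_of_column_eq hne, mul_zero]
      intro i
      rw [Matrix.updateCol_self, Matrix.updateCol_ne hne.symm]
  have hdetE : (A.updateCol ⟨n, hn⟩ fun i => v i - A i ⟨n, hn⟩ + w i).det = 0 := by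
    by_cases hxa : x (n + 1) ≤ a
    · refine Matrix.det_eq_zero_of_column_eq_zero ⟨n, hn⟩ fun i => ?_
      rw [Matrix.updateCol_self, hvw i, sub_sub_cancel_left, neg_add_cancel]
      rcases le_or_gt n i with h | h
      · exact Or.inr h
      · exact Or.inl ((hx (i + 1) (n + 1) (by omega) (by omega) (by omega)).trans hxa)
    -- Here all of `y` lies below `x (n + 1)`, so from row `n` on the earlier columns are cut off;
    -- in the same rows the closed form holds and the error is zero.
    · refine Matrix.det_eq_zero_of_lower_left_block ⟨n, hn⟩ fun i k hk hi => ?_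
      have hi' : n ≤ i := hi
      rcases hk.eq_or_lt with rfl | hk
      · rw [Matrix.updateCol_self, hvw i (Or.inr hi'), sub_sub_cancel_left, neg_add_cancel]
      · have hk' : (k : ℕ) < n := hk
        rw [Matrix.updateCol_ne hk.ne, hAlt i k hk', stepCol, causalFun_of_neg, mul_zero]
        have h1 := extendFin_mono_of_mem hy (k := k + 1) (l := n) hk' le_rfl
        rw [extendFin_succ _ hk'] at h1
        have h2 := hx (n + 1) (i + 1) (by omega) (by omega) (by omega)
        have h3 := not_le.1 hxa
        linarith
  calc (A.updateCol ⟨n, hn⟩ v).det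
      = (A.updateCol ⟨n, hn⟩ ((fun i => A i ⟨n, hn⟩) +
          (fun i => v i - A i ⟨n, hn⟩ + w i) - w)).det := by rw [← hsplit]
    _ = A.det := by
      rw [← Matrix.cramer_apply, map_sub, map_add, Pi.sub_apply, Pi.add_apply,
        Matrix.cramer_apply, Matrix.cramer_apply, Matrix.cramer_apply, hdetw, hdetE]
      simp

theorem integral_indicator_det_partialMatrix_snoc (hR : 0 < R)
    (hα : ∀ k ∈ Finset.Icc 1 (m + 1), |α k| < R)
    (hβ : ∀ k ∈ Finset.Icc 1 N, |β k| < R) (hm : 1 ≤ m)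
    (hx : ∀ i j, 1 ≤ i → i ≤ j → j ≤ N → x i ≤ x j) (hL : L < x 1)
    (hz0 : z 0 = L) (hz : ∀ k < N, z k ≤ z (k + 1)) (hn : n < N) (y : Fin n → ℝ) :
    ∫ t : ℝ, (interlacingBox L z (n + 1)).indicator
        (fun y => (partialMatrix α β R m N x z (n + 1) y).det) (Fin.snoc (α := fun _ => ℝ) y t) =
      (interlacingBox L z n).indicator
        (fun y => (partialMatrix α β R m N x z n y).det) y := by
  by_cases hy : y ∈ interlacingBox L z n
  · have hyz : extendFin L y n ≤ z n := by
      cases n with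
      | zero => rw [extendFin_zero, hz0]
      | succ n => exact (hy (Fin.last n)).2
    have hα' : ∀ k ∈ Finset.Icc 1 m, |α k| < R := fun k hk =>
      hα k (Finset.Icc_subset_Icc_right (Nat.le_succ m) hk)
    rw [Set.indicator_of_mem hy,
      ← det_updateCol_integral_stepCol hR hα hβ hm hx hL hn hy hyz (hz n hn),
      ← integral_det_updateCol _ _ fun i => intervalIntegrable_stepCol hR.le hα'
        (fun k hk => hβ k (Finset.Icc_subset_Icc_right (by omega) hk)) _ _,
      intervalIntegral.integral_of_le (hyz.trans (hz n hn)), ← integral_Icc_eq_integral_Ioc,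
      ← integral_indicator measurableSet_Icc]
    congr 1
    ext t
    by_cases ht : t ∈ Set.Icc (extendFin L y n) (z (n + 1))
    · rw [Set.indicator_of_mem ht, Set.indicator_of_mem (snoc_mem_interlacingBox.2 ⟨hy, ht⟩),
        partialMatrix_snoc hn]
    · rw [Set.indicator_of_notMem ht,
        Set.indicator_of_notMem fun h => ht (snoc_mem_interlacingBox.1 h).2]
  · rw [Set.indicator_of_notMem hy]
    simp [snoc_mem_interlacingBox, hy]

theorem integral_indicator_det_partialMatrix (hR : 0 < R)
    (hα : ∀ k ∈ Finset.Icc 1 (m + 1), |α k| < R)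
    (hβ : ∀ k ∈ Finset.Icc 1 N, |β k| < R) (hm : 1 ≤ m)
    (hx : ∀ i j, 1 ≤ i → i ≤ j → j ≤ N → x i ≤ x j) (hL : L < x 1)
    (hz0 : z 0 = L) (hz : ∀ k < N, z k ≤ z (k + 1)) (hn : n ≤ N) :
    ∫ y, (interlacingBox L z n).indicator
        (fun y => (partialMatrix α β R m N x z n y).det) y =
      (Matrix.of fun i j : Fin N => stepImage α β R m x z (i + 1) j).det := by
  induction n with
  | zero =>
    rw [integral_unique, Set.indicator_of_mem (show _ from fun k => k.elim0)]
    simp [partialMatrix, measureReal_def, volume_pi]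
  | succ n ih =>
    rw [integral_eq_integral_integral_snoc (integrable_indicator_det_partialMatrix hR.le
      (fun k hk => hα k (Finset.Icc_subset_Icc_right (Nat.le_succ m) hk)) hβ)]
    simp only [integral_indicator_det_partialMatrix_snoc hR hα hβ hm hx hL hz0 hz hn]
    exact ih (by omega)

/-- Each column of `stepImage` is the desired column plus a multiple of the desired column before
it. The first has no predecessor, because its second term is cut off by `z 0 = L < x 1`. -/
theorem det_stepImage
    (hx : ∀ i j, 1 ≤ i → i ≤ j → j ≤ N → x i ≤ x j) (hL : L < x 1) (hz0 : z 0 = L) :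
    (Matrix.of fun i j : Fin N => stepImage α β R m x z (i + 1) j).det =
      (∏ j : Fin N, Complex.exp (α (m + 1) * z (j + 1))) * (Matrix.of fun i j : Fin N =>
        causalFun α β R (m + 1) (i + 1) (j + 1) (z (j + 1) - x (i + 1))).det := by
  rw [← Matrix.det_mul_row]
  cases N with
  | zero => simp
  | succ N =>
    refine (Matrix.det_eq_of_forall_col_eq_smul_add_pred
      (fun j : Fin N => -((α (m + 1) : ℂ) + β (j + 1 + 1))) ?_ ?_).symm
    · intro i
      have := hx 1 (i + 1) le_rfl (by omega) (by omega)
      simp only [Matrix.of_apply, stepImage, Fin.val_zero]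
      rw [causalFun_of_neg (t := z 0 - x (i + 1)) (by linarith)]
      simp
    · intro i j
      simp only [Matrix.of_apply, stepImage, Fin.val_succ, Fin.val_castSucc]
      ring

end step

/-! ### The one-step density and the determinant for one step -/

/-- The density at `z` of the vector with coordinates `z_j = max (y_j) (z_{j-1}) + w_j`, where
`z_0 = L` and the `w_j` are independent exponential variables with rates `r_j`. -/
noncomputable def stepDensity (r : ℕ → ℝ) (L : ℝ) {N : ℕ} (y z : Fin N → ℝ) : ℝ :=
  ∏ j : Fin N, exponentialPDFReal (r (j + 1)) (z j - max (y j) (extendFin L z j))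

theorem exponentialPDFReal_eq_ite (r x : ℝ) :
    exponentialPDFReal r x = if 0 ≤ x then r * Real.exp (-(r * x)) else 0 := by
  simp [exponentialPDFReal, gammaPDFReal]

section density

variable {α β : ℕ → ℝ} {R : ℝ} {m N n : ℕ} {x : ℕ → ℝ} {L : ℝ}

theorem expEntry_eq (i j : ℕ) (xi yj : ℝ) :
    expEntry α β m R i j xi yj = Complex.exp (β i * xi) *
      (Complex.exp (-(β j * yj)) * (∏ k ∈ Finset.Icc 1 m, ((α k : ℂ) + β j)) *
        causalFun α β R m i j (yj - xi)) := by
  unfold expEntry causalFun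
  simp only [sub_nonneg]
  split_ifs
  · unfold contourFun
    have h : ∀ z : ℂ, Complex.exp ((yj : ℂ) * (z - β j) - (xi : ℂ) * (z - β i)) *
          ((∏ k ∈ Finset.Icc 1 j, (z - (β k : ℂ))) / (∏ k ∈ Finset.Icc 1 i, (z - (β k : ℂ)))) *
          ∏ k ∈ Finset.Icc 1 m, (((α k : ℂ) + (β j : ℂ)) / (z + (α k : ℂ))) =
        Complex.exp (β i * xi) *
          (Complex.exp (-(β j * yj)) * ∏ k ∈ Finset.Icc 1 m, ((α k : ℂ) + β j)) *
          (Complex.exp (((yj - xi : ℝ) : ℂ) * z) * contourRat α β m i j z) := by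
      intro z
      have he : Complex.exp ((yj : ℂ) * (z - β j) - (xi : ℂ) * (z - β i)) =
          Complex.exp (β i * xi) * Complex.exp (-(β j * yj)) *
            Complex.exp (((yj - xi : ℝ) : ℂ) * z) := by
        rw [← Complex.exp_add, ← Complex.exp_add]
        congr 1
        push_cast
        ring
      rw [he, contourRat]
      simp only [div_eq_mul_inv, Finset.prod_mul_distrib]
      ring
    simp only [h, circleIntegral.integral_const_mul]
    ring
  · simp

theorem det_expMatrix (y : Fin N → ℝ) :
    (expMatrix N α β m R x y).det =
      (∏ i : Fin N, Complex.exp (β (i + 1) * x (i + 1))) *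
        ((∏ j : Fin N, Complex.exp (-(β (j + 1) * y j)) *
          ∏ k ∈ Finset.Icc 1 m, ((α k : ℂ) + β (j + 1))) *
        (Matrix.of fun i j : Fin N =>
          causalFun α β R m (i + 1) (j + 1) (y j - x (i + 1))).det) := by
  rw [← Matrix.det_mul_row, ← Matrix.det_mul_column]
  congr 1
  ext i j
  exact expEntry_eq _ _ _ _

theorem det_causalFun_eq_zero {y : Fin N → ℝ} (hN : 0 < N)
    (hx : ∀ i j, 1 ≤ i → i ≤ j → j ≤ N → x i ≤ x j) (hy : y ⟨0, hN⟩ < x 1) :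
    (Matrix.of fun i j : Fin N =>
      causalFun α β R m (i + 1) (j + 1) (y j - x (i + 1))).det = 0 := by
  refine Matrix.det_eq_zero_of_column_eq_zero ⟨0, hN⟩ fun i => ?_
  have := hx 1 (i + 1) le_rfl (by omega) (by omega)
  exact causalFun_of_neg (by linarith)

theorem stepDensity_eq_zero {r : ℕ → ℝ} {y z : Fin N → ℝ} (j : Fin N)
    (h : z j < max (y j) (extendFin L z j)) : stepDensity r L y z = 0 := by
  refine Finset.prod_eq_zero (Finset.mem_univ j) ?_
  rw [exponentialPDFReal_eq_ite, if_neg (by linarith)]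

theorem mem_interlacingBox_self_of_monotone {z : Fin N → ℝ} (hz : Monotone z)
    (hL : ∀ h : 0 < N, L ≤ z ⟨0, h⟩) : z ∈ interlacingBox L (extendFin L z) N := by
  intro k
  refine ⟨?_, le_rfl⟩
  obtain ⟨k, hk⟩ := k
  simp only
  rw [extendFin_succ _ hk]
  cases k with
  | zero => exact hL hk
  | succ k =>
    rw [extendFin_succ _ (by omega : k < N)]
    exact hz (by simp)

theorem monotone_of_mem_interlacingBox {y : Fin N → ℝ} {z : ℕ → ℝ}
    (hy : y ∈ interlacingBox L z N) : Monotone y := by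
  intro k l hkl
  have h : (k : ℕ) ≤ l := hkl
  have := extendFin_mono_of_mem hy (k := k + 1) (l := l + 1) (by omega) (by omega)
  rwa [extendFin_val_succ, extendFin_val_succ] at this

/-- Inside the box the exponentials regroup into `stepWeight` and factors free of `y`. For `y` in
the Weyl chamber but outside the box, either some `y_j > z_j` and the density is zero, or `y_1 < L <
x_1` and the first column of the determinant is zero. -/
theorem indicator_det_expMatrix_mul_stepDensity
    (hx : ∀ i j, 1 ≤ i → i ≤ j → j ≤ N → x i ≤ x j) (hL : L < x 1)
    {z : Fin N → ℝ} (hz : z ∈ interlacingBox L (extendFin L z) N) (y : Fin N → ℝ) :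
    (weylChamber N).indicator (fun y => (expMatrix N α β m R x y).det *
        (stepDensity (fun j => α (m + 1) + β j) L y z : ℂ)) y =
      ((∏ i : Fin N, Complex.exp (β (i + 1) * x (i + 1))) *
        ∏ j : Fin N, (Complex.exp (-((α (m + 1) + β (j + 1)) * z j)) *
          ∏ k ∈ Finset.Icc 1 (m + 1), ((α k : ℂ) + β (j + 1)))) *
      (interlacingBox L (extendFin L z) N).indicator
        (fun y => (partialMatrix α β R m N x (extendFin L z) N y).det) y := by
  by_cases hy : y ∈ interlacingBox L (extendFin L z) N
  · rw [Set.indicator_of_mem hy, Set.indicator_of_mem (show y ∈ weylChamber N from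
      monotone_of_mem_interlacingBox hy), det_expMatrix]
    have hpart : (partialMatrix α β R m N x (extendFin L z) N y).det =
        (∏ j : Fin N, stepWeight (α (m + 1)) (β (j + 1)) (extendFin L z j) (y j)) *
        (Matrix.of fun i j : Fin N =>
          causalFun α β R m (i + 1) (j + 1) (y j - x (i + 1))).det := by
      rw [← Matrix.det_mul_row]
      congr 1
      ext i j
      simp [partialMatrix, stepCol]
    have hdens : (stepDensity (fun j => α (m + 1) + β j) L y z : ℂ) =
        ∏ j : Fin N, (((α (m + 1) : ℂ) + β (j + 1)) * Complex.exp (-((α (m + 1) + β (j + 1)) *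
          (z j - max (y j) (extendFin L z j) : ℝ)))) := by
      rw [stepDensity, Complex.ofReal_prod]
      refine Finset.prod_congr rfl fun j _ => ?_
      have h1 := (hy j).2
      have h2 := (hz j).1
      rw [extendFin_val_succ, extendFin_val_succ] at h1
      rw [extendFin_val_succ] at h2
      rw [exponentialPDFReal_eq_ite, if_pos (sub_nonneg.2 (max_le h1 h2))]
      push_cast
      rfl
    rw [hpart, hdens]
    have hprod : (∏ j : Fin N, Complex.exp (-(β (j + 1) * y j)) *
          ∏ k ∈ Finset.Icc 1 m, ((α k : ℂ) + β (j + 1))) *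
        (∏ j : Fin N, (((α (m + 1) : ℂ) + β (j + 1)) * Complex.exp (-((α (m + 1) + β (j + 1)) *
          (z j - max (y j) (extendFin L z j) : ℝ))))) =
        (∏ j : Fin N, (Complex.exp (-((α (m + 1) + β (j + 1)) * z j)) *
          ∏ k ∈ Finset.Icc 1 (m + 1), ((α k : ℂ) + β (j + 1)))) *
        ∏ j : Fin N, stepWeight (α (m + 1)) (β (j + 1)) (extendFin L z j) (y j) := by
      rw [← Finset.prod_mul_distrib, ← Finset.prod_mul_distrib]
      refine Finset.prod_congr rfl fun j _ => ?_
      have he : Complex.exp (-((α (m + 1) + β (j + 1)) *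
          (z j - max (y j) (extendFin L z j) : ℝ))) =
          Complex.exp (-((α (m + 1) + β (j + 1)) * z j)) *
          Complex.exp ((α (m + 1) + β (j + 1) : ℝ) * (max (y j) (extendFin L z j) : ℝ)) := by
        rw [← Complex.exp_add]
        congr 1
        push_cast
        ring
      have he' : Complex.exp (-(β (j + 1) * y j : ℂ)) =
          Complex.exp ((-β (j + 1) : ℝ) * y j) := by
        congr 1
        push_cast
        ring
      rw [Finset.prod_Icc_succ_top (by omega), stepWeight, he, he']
      ring
    rw [mul_assoc, mul_right_comm _ (Matrix.det _), hprod]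
    ring
  · rw [Set.indicator_of_notMem hy, mul_zero]
    by_cases hyW : y ∈ weylChamber N
    · rw [Set.indicator_of_mem hyW]
      by_cases hyz : ∃ j, z j < y j
      · obtain ⟨j, hj⟩ := hyz
        rw [stepDensity_eq_zero j (hj.trans_le (le_max_left _ _))]
        simp
      · push Not at hyz
        have hyL : ∃ h : 0 < N, y ⟨0, h⟩ < L := by
          by_contra! hcon
          refine hy fun k => ⟨(mem_interlacingBox_self_of_monotone hyW hcon k).1, ?_⟩
          rw [extendFin_val_succ, extendFin_val_succ]
          exact hyz k
        obtain ⟨hN, hyL⟩ := hyL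
        rw [det_expMatrix, det_causalFun_eq_zero hN hx (hyL.trans hL)]
        simp
    · rw [Set.indicator_of_notMem hyW]

theorem integral_det_expMatrix_mul_stepDensity (hR : 0 < R)
    (hα : ∀ k ∈ Finset.Icc 1 (m + 1), |α k| < R)
    (hβ : ∀ k ∈ Finset.Icc 1 N, |β k| < R) (hm : 1 ≤ m)
    (hx : ∀ i j, 1 ≤ i → i ≤ j → j ≤ N → x i ≤ x j) (hL : L < x 1)
    {z : Fin N → ℝ} (hz : z ∈ weylChamber N) :
    Integrable ((weylChamber N).indicator fun y => (expMatrix N α β m R x y).det *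
        (stepDensity (fun j => α (m + 1) + β j) L y z : ℂ)) ∧
    ∫ y, (weylChamber N).indicator (fun y => (expMatrix N α β m R x y).det *
        (stepDensity (fun j => α (m + 1) + β j) L y z : ℂ)) y =
      (expMatrix N α β (m + 1) R x z).det := by
  by_cases hzL : ∀ h : 0 < N, L ≤ z ⟨0, h⟩
  · have hzbox := mem_interlacingBox_self_of_monotone hz hzL
    have hα' : ∀ k ∈ Finset.Icc 1 m, |α k| < R := fun k hk =>
      hα k (Finset.Icc_subset_Icc_right (Nat.le_succ m) hk)
    have hfun := funext (indicator_det_expMatrix_mul_stepDensity (α := α) (β := β) (R := R)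
      (m := m) hx hL hzbox)
    rw [hfun]
    refine ⟨(integrable_indicator_det_partialMatrix hR.le hα' hβ).const_mul _, ?_⟩
    rw [integral_const_mul, integral_indicator_det_partialMatrix hR hα hβ hm hx hL
      (extendFin_zero z) (fun k hk => (hzbox ⟨k, hk⟩).1) le_rfl,
      det_stepImage hx hL (extendFin_zero z), det_expMatrix, mul_assoc]
    congr 1
    rw [← mul_assoc, ← Finset.prod_mul_distrib]
    simp only [extendFin_val_succ]
    congr 1
    refine Finset.prod_congr rfl fun j _ => ?_
    rw [mul_right_comm, ← Complex.exp_add]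
    congr 2
    ring
  · push Not at hzL
    obtain ⟨hN, hzL⟩ := hzL
    have hdens : ∀ y : Fin N → ℝ, stepDensity (fun j => α (m + 1) + β j) L y z = 0 := fun y =>
      stepDensity_eq_zero ⟨0, hN⟩ (hzL.trans_le (le_max_right _ _))
    rw [det_expMatrix, det_causalFun_eq_zero hN hx (hzL.trans hL)]
    simp [hdens]

/-- The zero-step kernels involved vanish. Hence `exp (α t)` times the one-step kernel is constant
between `z j` and `z (j + 1)`, and the difference identity makes the two terms of `stepImage`
cancel. -/
theorem stepImage_zero_of_lt (hR : 0 < R) (hα : |α 1| < R)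
    (hβ : ∀ k ∈ Finset.Icc 1 N, |β k| < R) {z : ℕ → ℝ} {i j : ℕ} (hi : i ≤ j) (hiN : i ≤ N)
    (hz : z j ≤ z (j + 1)) (hxz : x i ≤ z j) : stepImage α β R 0 x z i j = 0 := by
  have hα' : ∀ k ∈ Finset.Icc 1 (0 + 1), |α k| < R := by simpa using hα
  have hβ' : ∀ k ∈ Finset.Icc 1 i, |β k| < R := fun k hk =>
    hβ k (Finset.Icc_subset_Icc_right hiN hk)
  have h1 := integral_exp_mul_causalFun_succ (j := j + 1) hR hα' hβ' hz (Or.inl hxz)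
  have h2 := causalFun_sub_causalFun (j := j) hR.le hα' hβ' (z j - x i)
  have h0 : ∀ k t, i ≤ k → causalFun α β R 0 i k t = 0 := fun k t hk => by
    simp [causalFun, contourFun_zero_left_of_le hR hβ' hk]
  simp only [h0 (j + 1) _ (by omega), mul_zero, intervalIntegral.integral_zero] at h1
  rw [h0 j _ hi, zero_sub] at h2
  rw [stepImage, mul_left_comm, ← h2]
  linear_combination -h1

theorem stepImage_zero_diag (hR : 0 < R) (hα : |α 1| < R)
    (hβ : ∀ k ∈ Finset.Icc 1 N, |β k| < R) {z : ℕ → ℝ} {j : ℕ} (hj : j < N)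
    (hz : z j ≤ z (j + 1)) : stepImage α β R 0 x z (j + 1) j =
      if x (j + 1) ≤ z (j + 1) then
        Complex.exp ((α 1 + β (j + 1)) * (max (x (j + 1)) (z j) : ℝ) - β (j + 1) * x (j + 1))
      else 0 := by
  have hα' : ∀ k ∈ Finset.Icc 1 (0 + 1), |α k| < R := by simpa using hα
  have hβ' : ∀ k ∈ Finset.Icc 1 (j + 1), |β k| < R := fun k hk =>
    hβ k (Finset.Icc_subset_Icc_right hj hk)
  by_cases h1 : x (j + 1) ≤ z (j + 1)
  · have hfst : Complex.exp (α 1 * z (j + 1)) *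
        causalFun α β R 1 (j + 1) (j + 1) (z (j + 1) - x (j + 1)) =
        Complex.exp (α 1 * x (j + 1)) := by
      rw [causalFun, if_pos (sub_nonneg.2 h1), contourFun_one_left_self hR hα hβ',
        ← Complex.exp_add]
      congr 1
      push_cast
      ring
    rw [if_pos h1, stepImage]
    simp only [zero_add, hfst]
    by_cases h2 : x (j + 1) ≤ z j
    · have h3 := causalFun_sub_causalFun (j := j) hR.le hα' hβ' (z j - x (j + 1))
      simp only [zero_add] at h3
      rw [mul_left_comm, ← h3, max_eq_right h2, causalFun, causalFun,
        if_pos (sub_nonneg.2 h2), if_pos (sub_nonneg.2 h2), contourFun_one_left_self hR hα hβ',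
        contourFun_zero_left_succ hR hβ', mul_sub, ← Complex.exp_add, ← Complex.exp_add]
      rw [show (α 1 : ℂ) * z j + -(α 1 * ((z j - x (j + 1) : ℝ) : ℂ)) = α 1 * x (j + 1) by
        push_cast; ring, add_sub_cancel]
      congr 1
      push_cast
      ring
    · rw [causalFun_of_neg (by linarith), max_eq_left (not_le.1 h2).le]
      simp only [mul_zero, add_zero]
      congr 1
      ring
  · rw [if_neg h1, stepImage, causalFun_of_neg (by linarith), causalFun_of_neg (by linarith)]
    simp

/-- By `det_stepImage` with `m = 0` it suffices to evaluate the determinant of `stepImage`, whose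
diagonal entries give the exponential densities. -/
theorem det_expMatrix_one (hR : 0 < R) (hα : |α 1| < R)
    (hβ : ∀ k ∈ Finset.Icc 1 N, |β k| < R)
    (hx : ∀ i j, 1 ≤ i → i ≤ j → j ≤ N → x i ≤ x j) (hL : L < x 1)
    {z : Fin N → ℝ} (hz : z ∈ weylChamber N) :
    (expMatrix N α β 1 R x z).det =
      (stepDensity (fun j => α 1 + β j) L (fun j : Fin N => x (j + 1)) z : ℂ) := by
  by_cases hzL : ∀ h : 0 < N, L ≤ z ⟨0, h⟩
  · have hzbox := mem_interlacingBox_self_of_monotone hz hzL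
    have htri : (Matrix.of fun i j : Fin N => stepImage α β R 0 x (extendFin L z) (i + 1) j).det =
        ∏ j : Fin N, stepImage α β R 0 x (extendFin L z) (j + 1) j := by
      -- A non-zero entry above the diagonal forces `z_n < x_{i+1}`; then every column before `n` is
      -- cut off in all rows from `n` on.
      refine Matrix.det_eq_prod_diag_of_forall_block fun i n hin hne i' k hk hi' => ?_
      have hin' : (i : ℕ) < n := hin
      have hk' : (k : ℕ) < n := hk
      have hi'' : (n : ℕ) ≤ i' := hi'
      have h1 : extendFin L z n < x (i + 1) := by
        by_contra! h
        exact hne (stepImage_zero_of_lt hR hα hβ hin' i.2 (hzbox n).1 h)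
      have h2 := extendFin_mono_of_mem hzbox (k := k + 1) (l := n) hk' n.2.le
      have h3 := hx (i + 1) (i' + 1) (by omega) (by omega) (by omega)
      have h4 := (hzbox k).1
      simp only [Matrix.of_apply, stepImage]
      rw [causalFun_of_neg (by linarith), causalFun_of_neg (by linarith)]
      simp
    have hdet := det_stepImage (α := α) (β := β) (R := R) (m := 0) hx hL (extendFin_zero z)
    rw [htri] at hdet
    simp only [zero_add, extendFin_val_succ] at hdet
    have hne : ∏ j : Fin N, Complex.exp (α 1 * z j) ≠ 0 :=
      Finset.prod_ne_zero_iff.2 fun _ _ => Complex.exp_ne_zero _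
    have hcomm : ∀ a b c d : ℂ, a * (b * (c * d)) = b * (c * (a * d)) := fun a b c d => by ring
    rw [← mul_right_inj' hne, det_expMatrix, hcomm, ← hdet,
      stepDensity, Complex.ofReal_prod, ← Finset.prod_mul_distrib, ← Finset.prod_mul_distrib,
      ← Finset.prod_mul_distrib]
    refine Finset.prod_congr rfl fun j _ => ?_
    rw [stepImage_zero_diag hR hα hβ j.2 (hzbox j).1, extendFin_val_succ,
      exponentialPDFReal_eq_ite]
    have h1 := (hzbox j).1
    rw [extendFin_val_succ] at h1
    simp only [sub_nonneg, max_le_iff, h1, and_true, Finset.Icc_self, Finset.prod_singleton]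
    split_ifs
    · push_cast
      have he : ∀ a b c d e f : ℂ, a + b + c = d + e →
          Complex.exp a * (Complex.exp b * f * Complex.exp c) =
          Complex.exp d * (f * Complex.exp e) := fun a b c d e f h => by
        rw [mul_right_comm (Complex.exp b), ← Complex.exp_add, ← mul_assoc, ← Complex.exp_add,
          ← add_assoc, h, Complex.exp_add]
        ring
      refine he _ _ _ _ _ _ ?_
      ring
    · simp
  · push Not at hzL
    obtain ⟨hN, hzL⟩ := hzL
    rw [det_expMatrix, det_causalFun_eq_zero hN hx (hzL.trans hL),
      stepDensity_eq_zero ⟨0, hN⟩ (hzL.trans_le (le_max_right _ _))]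
    simp

end density

/-! ### The law of one step of the recursion -/

/-- The recursion `z_0 = L`, `z_j = max (y_j) (z_{j-1}) + w_j`. -/
def stepRec (L : ℝ) (y w : ℕ → ℝ) : ℕ → ℝ
  | 0 => L
  | n + 1 => max (y (n + 1)) (stepRec L y w n) + w (n + 1)

/-- The vector `(z_1, …, z_n)` of the recursion `stepRec`. -/
def stepVec (L : ℝ) {N n : ℕ} (y : Fin N → ℝ) (w : Fin n → ℝ) : Fin n → ℝ :=
  fun j => stepRec L (extendFin L y) (extendFin L w) (j + 1)

section stepVec

variable {L : ℝ} {N n : ℕ}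

theorem stepRec_congr {y w w' : ℕ → ℝ} {k : ℕ} (h : ∀ l, 1 ≤ l → l ≤ k → w l = w' l) :
    stepRec L y w k = stepRec L y w' k := by
  induction k with
  | zero => rfl
  | succ k ih =>
    rw [stepRec, stepRec, ih fun l h1 h2 => h l h1 (by omega), h (k + 1) (by omega) le_rfl]

theorem extendFin_stepVec (y : Fin N → ℝ) (w : Fin n → ℝ) {k : ℕ} (hk : k ≤ n) :
    extendFin L (stepVec L y w) k = stepRec L (extendFin L y) (extendFin L w) k := by
  cases k with
  | zero => rfl
  | succ k => rw [extendFin_succ _ (by omega : k < n)]; rfl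

theorem stepVec_apply (y w : Fin N → ℝ) (j : Fin N) :
    stepVec L y w j = max (y j) (extendFin L (stepVec L y w) j) + w j := by
  rw [extendFin_stepVec _ _ j.2.le, stepVec, stepRec, extendFin_val_succ, extendFin_val_succ]

theorem stepVec_snoc (y : Fin N → ℝ) (w : Fin n → ℝ) (t : ℝ) :
    stepVec L y (Fin.snoc (α := fun _ => ℝ) w t : Fin (n + 1) → ℝ) =
      Fin.snoc (α := fun _ => ℝ) (stepVec L y w)
        (max (extendFin L y (n + 1)) (stepRec L (extendFin L y) (extendFin L w) n) + t) := by
  have h : ∀ k ≤ n, stepRec L (extendFin L y)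
      (extendFin L (Fin.snoc (α := fun _ => ℝ) w t : Fin (n + 1) → ℝ)) k =
      stepRec L (extendFin L y) (extendFin L w) k := fun k hk =>
    stepRec_congr fun l _ hl => extendFin_snoc_of_le w t (hl.trans hk)
  ext j
  induction j using Fin.lastCases with
  | last =>
    rw [Fin.snoc_last, stepVec, Fin.val_last, stepRec, extendFin_snoc_last, h n le_rfl]
  | cast j =>
    rw [Fin.snoc_castSucc, stepVec, Fin.val_castSucc, h _ j.2]
    rfl

theorem measurable_stepRec (k : ℕ) : Measurable fun p : (Fin N → ℝ) × (Fin n → ℝ) =>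
    stepRec L (extendFin L p.1) (extendFin L p.2) k := by
  induction k with
  | zero => exact measurable_const
  | succ k ih =>
    have h1 : Measurable fun p : (Fin N → ℝ) × (Fin n → ℝ) => extendFin L p.1 (k + 1) :=
      (measurable_extendFin (L := L) (n := N) (k + 1)).comp measurable_fst
    have h2 : Measurable fun p : (Fin N → ℝ) × (Fin n → ℝ) => extendFin L p.2 (k + 1) :=
      (measurable_extendFin (L := L) (n := n) (k + 1)).comp measurable_snd
    exact (h1.max ih).add h2

theorem measurable_stepVec :
    Measurable fun p : (Fin N → ℝ) × (Fin n → ℝ) => stepVec L p.1 p.2 :=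
  measurable_pi_iff.2 fun _ => measurable_stepRec _

theorem measurable_snoc : Measurable fun p : (Fin n → ℝ) × ℝ =>
    (Fin.snoc (α := fun _ => ℝ) p.1 p.2 : Fin (n + 1) → ℝ) := by
  refine measurable_pi_iff.2 fun j => ?_
  induction j using Fin.lastCases with
  | last =>
    simp only [Fin.snoc_last]
    exact measurable_snd
  | cast j =>
    simp only [Fin.snoc_castSucc]
    exact (measurable_pi_apply j).comp measurable_fst

theorem measurable_prod_apply {f : Fin n → ℝ → ENNReal} (hf : ∀ j, Measurable (f j)) :
    Measurable fun w : Fin n → ℝ => ∏ j, f j (w j) :=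
  Finset.measurable_fun_prod _ fun j _ => (hf j).comp (measurable_pi_apply j)

/-- Given the earlier weights, the last coordinate is merely translated, and Lebesgue measure is
translation invariant. -/
theorem lintegral_comp_stepVec (y : Fin N → ℝ) {g : (Fin n → ℝ) → ENNReal} (hg : Measurable g) :
    ∫⁻ w, g (stepVec L y w) = ∫⁻ z, g z := by
  have hmeas : ∀ n, Measurable fun w : Fin n → ℝ => stepVec L y w := fun n =>
    measurable_stepVec.comp measurable_prodMk_left
  induction n with
  | zero => exact lintegral_congr fun w => by rw [Subsingleton.elim (stepVec L y w) w]
  | succ n ih =>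
    have hgc : Measurable fun w : Fin (n + 1) → ℝ => g (stepVec L y w) := hg.comp (hmeas _)
    rw [lintegral_eq_lintegral_lintegral_snoc hgc, lintegral_eq_lintegral_lintegral_snoc hg]
    simp only [stepVec_snoc]
    have h1 : ∀ w : Fin n → ℝ, ∫⁻ t : ℝ, g (Fin.snoc (α := fun _ => ℝ) (stepVec L y w)
        (max (extendFin L y (n + 1)) (stepRec L (extendFin L y) (extendFin L w) n) + t)) =
        ∫⁻ t : ℝ, g (Fin.snoc (α := fun _ => ℝ) (stepVec L y w) t) := fun w =>
      lintegral_add_left_eq_self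
        (fun t => g (Fin.snoc (α := fun _ => ℝ) (stepVec L y w) t)) _
    simp only [h1]
    refine ih (g := fun z => ∫⁻ t : ℝ, g (Fin.snoc (α := fun _ => ℝ) z t)) ?_
    exact Measurable.lintegral_prod_right' (f := fun p : (Fin n → ℝ) × ℝ =>
      g (Fin.snoc (α := fun _ => ℝ) p.1 p.2)) (hg.comp measurable_snoc)

theorem lintegral_prod_fin (f : Fin n → ℝ → ENNReal) (hf : ∀ j, Measurable (f j)) :
    ∫⁻ w : Fin n → ℝ, ∏ j, f j (w j) = ∏ j, ∫⁻ t, f j t := by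
  induction n with
  | zero => simp [volume_pi]
  | succ n ih =>
    rw [lintegral_eq_lintegral_lintegral_snoc (measurable_prod_apply hf)]
    simp only [Fin.prod_univ_castSucc, Fin.snoc_castSucc, Fin.snoc_last]
    simp only [lintegral_const_mul _ (hf (Fin.last n))]
    rw [lintegral_mul_const _ (measurable_prod_apply fun j => hf _), ih _ fun j => hf _]

theorem pi_withDensity_fin (f : Fin n → ℝ → ENNReal) (hf : ∀ j, Measurable (f j))
    [∀ j, SigmaFinite (volume.withDensity (f j))] :
    Measure.pi (fun j => volume.withDensity (f j)) =
      volume.withDensity fun w : Fin n → ℝ => ∏ j, f j (w j) := by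
  refine Measure.pi_eq fun s hs => ?_
  rw [withDensity_apply _ (MeasurableSet.univ_pi hs),
    ← lintegral_indicator (MeasurableSet.univ_pi hs)]
  have h : ∀ w : Fin n → ℝ, (Set.univ.pi s).indicator (fun w => ∏ j, f j (w j)) w =
      ∏ j, (s j).indicator (f j) (w j) := by
    intro w
    by_cases hw : w ∈ Set.univ.pi s
    · rw [Set.indicator_of_mem hw]
      exact Finset.prod_congr rfl fun j _ => (Set.indicator_of_mem (hw j trivial) _).symm
    · rw [Set.indicator_of_notMem hw]
      simp only [Set.mem_pi, Set.mem_univ, true_imp_iff, not_forall] at hw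
      obtain ⟨j, hj⟩ := hw
      exact (Finset.prod_eq_zero (Finset.mem_univ j) (Set.indicator_of_notMem hj _)).symm
  simp only [h]
  rw [lintegral_prod_fin _ fun j => (hf j).indicator (hs j)]
  refine Finset.prod_congr rfl fun j _ => ?_
  rw [withDensity_apply _ (hs j), lintegral_indicator (hs j)]

theorem measurable_stepDensity (r : ℕ → ℝ) :
    Measurable fun p : (Fin N → ℝ) × (Fin N → ℝ) => stepDensity r L p.1 p.2 := by
  unfold stepDensity
  refine Finset.measurable_fun_prod _ fun j _ => (measurable_exponentialPDFReal _).comp ?_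
  exact (measurable_pi_apply j |>.comp measurable_snd).sub
    ((measurable_pi_apply j |>.comp measurable_fst).max
      ((measurable_extendFin _).comp measurable_snd))

theorem lintegral_stepVec_pi_expMeasure {r : ℕ → ℝ} (hr : ∀ j : Fin N, 0 < r (j + 1))
    (y : Fin N → ℝ) {g : (Fin N → ℝ) → ENNReal} (hg : Measurable g) :
    ∫⁻ w, g (stepVec L y w) ∂(Measure.pi fun j : Fin N => expMeasure (r (j + 1))) =
      ∫⁻ z, ENNReal.ofReal (stepDensity r L y z) * g z := by
  have hprob := fun j => isProbabilityMeasure_expMeasure (hr j)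
  have hpdf : ∀ r, Measurable (exponentialPDF r) := fun r =>
    (measurable_exponentialPDFReal r).ennreal_ofReal
  have hexp : ∀ r, expMeasure r = volume.withDensity (exponentialPDF r) := fun _ => rfl
  have hstep : Measurable fun w : Fin N → ℝ => stepVec L y w :=
    measurable_stepVec.comp measurable_prodMk_left
  simp only [hexp] at hprob ⊢
  have hgc : Measurable fun w : Fin N → ℝ => g (stepVec L y w) := hg.comp hstep
  have hdens : Measurable fun z : Fin N → ℝ => ENNReal.ofReal (stepDensity r L y z) * g z :=
    (((measurable_stepDensity (L := L) r).comp
      (measurable_prodMk_left (x := y))).ennreal_ofReal).mul hg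
  rw [pi_withDensity_fin _ fun j => hpdf _, lintegral_withDensity_eq_lintegral_mul _
    (measurable_prod_apply fun j => hpdf _) hgc, ← lintegral_comp_stepVec (L := L) y hdens]
  refine lintegral_congr fun w => ?_
  simp only [Pi.mul_apply]
  congr 1
  have hd : ∀ j, stepVec L y w j - max (y j) (extendFin L (stepVec L y w) j) = w j := fun j => by
    rw [sub_eq_iff_eq_add', ← stepVec_apply]
  simp only [stepDensity, hd]
  rw [ENNReal.ofReal_prod_of_nonneg fun j _ => exponentialPDFReal_nonneg (hr j) _]
  rfl

end stepVec

theorem map_stepVec_eq_withDensity {Ω : Type*} [MeasurableSpace Ω] {P : Measure Ω}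
    [IsProbabilityMeasure P] {N : ℕ} {L : ℝ} {r : ℕ → ℝ} (hr : ∀ j : Fin N, 0 < r (j + 1))
    {Y V : Ω → Fin N → ℝ} (hY : Measurable Y) (hV : Measurable V) (hYV : IndepFun Y V P)
    {S : Set (Fin N → ℝ)} {p : (Fin N → ℝ) → ℝ} (hp : Measurable p)
    (hYlaw : P.map Y = (volume.restrict S).withDensity fun y => ENNReal.ofReal (p y))
    (hVlaw : P.map V = Measure.pi fun j : Fin N => expMeasure (r (j + 1))) :
    P.map (fun s => stepVec L (Y s) (V s)) =
      volume.withDensity fun z => ∫⁻ y in S,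
        ENNReal.ofReal (p y) * ENNReal.ofReal (stepDensity r L y z) := by
  have hD : Measurable fun q : (Fin N → ℝ) × (Fin N → ℝ) =>
      ENNReal.ofReal (stepDensity r L q.1 q.2) := (measurable_stepDensity r).ennreal_ofReal
  have hpD : Measurable fun q : (Fin N → ℝ) × (Fin N → ℝ) =>
      ENNReal.ofReal (p q.1) * ENNReal.ofReal (stepDensity r L q.1 q.2) :=
    (hp.comp measurable_fst).ennreal_ofReal.mul hD
  have hdens : Measurable fun z : Fin N → ℝ => ∫⁻ y in S,
      ENNReal.ofReal (p y) * ENNReal.ofReal (stepDensity r L y z) :=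
    Measurable.lintegral_prod_left' hpD
  refine Measure.ext_of_lintegral _ fun g hg => ?_
  have hgstep : Measurable fun q : (Fin N → ℝ) × (Fin N → ℝ) => g (stepVec L q.1 q.2) :=
    hg.comp measurable_stepVec
  have hDg : Measurable fun q : (Fin N → ℝ) × (Fin N → ℝ) =>
      ENNReal.ofReal (stepDensity r L q.1 q.2) * g q.2 := hD.mul (hg.comp measurable_snd)
  have hpDg : Measurable fun q : (Fin N → ℝ) × (Fin N → ℝ) =>
      ENNReal.ofReal (p q.1) * (ENNReal.ofReal (stepDensity r L q.1 q.2) * g q.2) :=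
    (hp.comp measurable_fst).ennreal_ofReal.mul hDg
  have hinner : Measurable fun y : Fin N → ℝ =>
      ∫⁻ z, ENNReal.ofReal (stepDensity r L y z) * g z := Measurable.lintegral_prod_right' hDg
  calc ∫⁻ z, g z ∂(P.map fun s => stepVec L (Y s) (V s))
      = ∫⁻ s, g (stepVec L (Y s) (V s)) ∂P :=
        lintegral_map hg (measurable_stepVec.comp (hY.prodMk hV))
    _ = ∫⁻ q, g (stepVec L q.1 q.2) ∂(P.map fun s => (Y s, V s)) :=
        (lintegral_map hgstep (hY.prodMk hV)).symm
    _ = ∫⁻ y, ∫⁻ w, g (stepVec L y w) ∂(P.map V) ∂(P.map Y) := by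
        rw [(indepFun_iff_map_prod_eq_prod_map_map hY.aemeasurable hV.aemeasurable).1 hYV,
          lintegral_prod _ hgstep.aemeasurable]
    _ = ∫⁻ y, (∫⁻ z, ENNReal.ofReal (stepDensity r L y z) * g z) ∂(P.map Y) := by
        rw [hVlaw]
        simp only [lintegral_stepVec_pi_expMeasure hr _ hg]
    _ = ∫⁻ y in S, ∫⁻ z, ENNReal.ofReal (p y) * (ENNReal.ofReal (stepDensity r L y z) * g z) := by
        rw [hYlaw, lintegral_withDensity_eq_lintegral_mul _ hp.ennreal_ofReal hinner]
        refine lintegral_congr fun y => ?_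
        have hy : Measurable fun z : Fin N → ℝ => (y, z) := measurable_prodMk_left
        have hDgy : Measurable fun z : Fin N → ℝ =>
            ENNReal.ofReal (stepDensity r L y z) * g z := (hD.comp hy).mul hg
        rw [Pi.mul_apply, lintegral_const_mul _ hDgy]
    _ = ∫⁻ z, ∫⁻ y in S, ENNReal.ofReal (p y) * (ENNReal.ofReal (stepDensity r L y z) * g z) :=
        lintegral_lintegral_swap (f := fun y z =>
          ENNReal.ofReal (p y) * (ENNReal.ofReal (stepDensity r L y z) * g z)) hpDg.aemeasurable
    _ = ∫⁻ z, g z ∂(volume.withDensity fun z => ∫⁻ y in S,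
          ENNReal.ofReal (p y) * ENNReal.ofReal (stepDensity r L y z)) := by
        rw [lintegral_withDensity_eq_lintegral_mul _ hdens hg]
        refine lintegral_congr fun z => ?_
        have hpDz : Measurable fun y : Fin N → ℝ =>
            ENNReal.ofReal (p y) * ENNReal.ofReal (stepDensity r L y z) :=
          hpD.comp (measurable_prodMk_right (y := z))
        rw [Pi.mul_apply, ← lintegral_mul_const _ hpDz]
        simp only [mul_assoc]

theorem map_stepVec_const_eq_withDensity {Ω : Type*} [MeasurableSpace Ω] {P : Measure Ω}
    {N : ℕ} {L : ℝ} {r : ℕ → ℝ} (hr : ∀ j : Fin N, 0 < r (j + 1))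
    {V : Ω → Fin N → ℝ} (hV : Measurable V)
    (hVlaw : P.map V = Measure.pi fun j : Fin N => expMeasure (r (j + 1))) (y : Fin N → ℝ) :
    P.map (fun s => stepVec L y (V s)) =
      volume.withDensity fun z => ENNReal.ofReal (stepDensity r L y z) := by
  have hstep : Measurable fun w : Fin N → ℝ => stepVec L y w :=
    measurable_stepVec.comp measurable_prodMk_left
  have hD : Measurable fun z : Fin N → ℝ => ENNReal.ofReal (stepDensity r L y z) :=
    ((measurable_stepDensity r).comp (measurable_prodMk_left (x := y))).ennreal_ofReal
  refine Measure.ext_of_lintegral _ fun g hg => ?_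
  have hgstep : Measurable fun w : Fin N → ℝ => g (stepVec L y w) := hg.comp hstep
  have hstepV : Measurable fun s => stepVec L y (V s) := hstep.comp hV
  rw [lintegral_map hg hstepV, ← lintegral_map hgstep hV, hVlaw,
    lintegral_withDensity_eq_lintegral_mul _ hD hg]
  exact lintegral_stepVec_pi_expMeasure hr y hg

theorem measurableSet_weylChamber (N : ℕ) : MeasurableSet (weylChamber N) := by
  have h : weylChamber N = ⋂ (i : Fin N) (j : Fin N) (_ : i ≤ j), {z | z i ≤ z j} := by
    ext z
    simp only [Set.mem_iInter, Set.mem_ofPred_eq]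
    exact ⟨fun h i j hij => h hij, fun h i j hij => h i j hij⟩
  rw [h]
  exact MeasurableSet.iInter fun i => MeasurableSet.iInter fun j => MeasurableSet.iInter fun _ =>
    measurableSet_le (measurable_pi_apply i) (measurable_pi_apply j)

theorem stepDensity_of_notMem_weylChamber {N : ℕ} {L : ℝ} {r : ℕ → ℝ} {y z : Fin N → ℝ}
    (hz : z ∉ weylChamber N) : stepDensity r L y z = 0 := by
  by_contra h
  refine hz (monotone_of_mem_interlacingBox (L := L) (z := extendFin L z) fun k => ⟨?_, le_rfl⟩)
  by_contra! hk
  rw [extendFin_val_succ] at hk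
  exact h (stepDensity_eq_zero k (hk.trans_le (le_max_right _ _)))

/-! ### The growth function and its law -/

/-- The vector `(G(k,1), …, G(k,N))`, with boundary values `L` in place of `c`. -/
def lppVec (N : ℕ) (L : ℝ) (x : ℕ → ℝ) (w : ℕ → ℕ → ℝ) : ℕ → Fin N → ℝ
  | 0 => fun j => x (j + 1)
  | k + 1 => stepVec L (lppVec N L x w k) fun j : Fin N => w (k + 1) (j + 1)

/-- Non-negative weights keep the first coordinate at least `x 1`, so a boundary value `≤ x 1`, be
it `c` or `L`, never decides the maximum. The lower bound is carried along in the induction. -/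
theorem growth_eq_lppVec {N : ℕ} {L : ℝ} {x : ℕ → ℝ} {w : ℕ → ℕ → ℝ} {c : WithBot ℝ}
    (hc : c ≤ (x 1 : WithBot ℝ)) (hL : L ≤ x 1) {k : ℕ}
    (hw : ∀ i j, 1 ≤ i → i ≤ k → 1 ≤ j → j ≤ N → 0 ≤ w i j) :
    (∀ n (hn : n < N), growth c x w k (n + 1) = (lppVec N L x w k ⟨n, hn⟩ : WithBot ℝ)) ∧
      ∀ hN : 0 < N, x 1 ≤ lppVec N L x w k ⟨0, hN⟩ := by
  induction k with
  | zero => exact ⟨fun n hn => by simp [growth, lppVec], fun hN => by simp [lppVec]⟩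
  | succ k ih =>
    obtain ⟨ih1, ih2⟩ := ih fun i j h1 h2 => hw i j h1 (by omega)
    have hvec : ∀ n (hn : n < N), lppVec N L x w (k + 1) ⟨n, hn⟩ =
        max (lppVec N L x w k ⟨n, hn⟩) (extendFin L (lppVec N L x w (k + 1)) n) +
          w (k + 1) (n + 1) := fun n hn => by
      conv_lhs => rw [lppVec, stepVec_apply]
      rfl
    refine ⟨fun n hn => ?_, fun hN => ?_⟩
    · induction n with
      | zero =>
        rw [growth, ih1 0 hn, hvec, extendFin_zero, max_eq_left (hL.trans (ih2 hn))]
        have h1 : growth c x w (k + 1) 0 = c := by rw [growth]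
        have h2 : (x 1 : WithBot ℝ) ≤ (lppVec N L x w k ⟨0, hn⟩ : WithBot ℝ) :=
          WithBot.coe_le_coe.2 (ih2 hn)
        rw [h1, max_eq_left (hc.trans h2)]
        rfl
      | succ n ihn =>
        rw [growth, ih1 _ hn, ihn (by omega), hvec (n + 1), extendFin_succ _ (by omega : n < N)]
        rfl
    · rw [hvec]
      have := hw (k + 1) 1 (by omega) le_rfl le_rfl hN
      exact (ih2 hN).trans ((le_max_left _ _).trans (le_add_of_nonneg_right this))

theorem measurable_lppVec {Ω : Type*} [MeasurableSpace Ω] {N : ℕ} {L : ℝ} {x : ℕ → ℝ}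
    {ω : ℕ → ℕ → Ω → ℝ} {k : ℕ}
    (hω : ∀ i j, 1 ≤ i → i ≤ k → 1 ≤ j → j ≤ N → Measurable (ω i j)) :
    Measurable fun s => lppVec N L x (fun i j => ω i j s) k := by
  induction k with
  | zero => exact measurable_const
  | succ k ih =>
    have h1 := ih fun i j h1 h2 => hω i j h1 (by omega)
    have h2 : Measurable fun s => fun j : Fin N => ω (k + 1) (j + 1) s :=
      measurable_pi_iff.2 fun j => hω _ _ (by omega) le_rfl (by omega) (by omega)
    exact measurable_stepVec.comp (h1.prodMk h2)

section law

variable {Ω : Type*} [MeasurableSpace Ω] {P : Measure Ω}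
  {N m : ℕ} {α β : ℕ → ℝ} {ω : ℕ → ℕ → Ω → ℝ} {x : ℕ → ℝ} {L R : ℝ}

/-- The vector after `k` steps is measurable for the σ-algebra of rows `1, …, k`, which is
independent of that of row `k + 1`. -/
theorem indepFun_lppVec_row (hω : ∀ i j, Measurable (ω i j))
    (hindep : iIndepFun
      (fun p : Finset.Icc 1 m × Finset.Icc 1 N => ω (p.1 : ℕ) (p.2 : ℕ)) P)
    {k : ℕ} (hk : k + 1 ≤ m) :
    IndepFun (fun s => lppVec N L x (fun i j => ω i j s) k)
      (fun s => fun j : Fin N => ω (k + 1) (j + 1) s) P := by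
  have h := indep_iSup_of_disjoint (fun p => (hω _ _).comap_le) hindep.iIndep
    (S := {p | (p.1 : ℕ) ≤ k}) (T := {p | (p.1 : ℕ) = k + 1})
    (Set.disjoint_left.2 fun p (h1 : (p.1 : ℕ) ≤ k) (h2 : (p.1 : ℕ) = k + 1) => by omega)
  rw [IndepFun_iff_Indep]
  let 𝓕 : Set (Finset.Icc 1 m × Finset.Icc 1 N) → MeasurableSpace Ω := fun S =>
    ⨆ p ∈ S, (inferInstance : MeasurableSpace ℝ).comap (ω (p.1 : ℕ) (p.2 : ℕ))
  have hle : ∀ S p, p ∈ S → Measurable[𝓕 S] (ω (p.1 : ℕ) (p.2 : ℕ)) := fun S p hp =>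
    measurable_iff_comap_le.2 (le_iSup₂_of_le p hp le_rfl)
  refine indep_of_indep_of_le h ?_ ?_
  · have h1 := @measurable_lppVec Ω (𝓕 {p | (p.1 : ℕ) ≤ k}) N L x ω k fun i j h1 h2 h3 h4 =>
      hle _ (⟨i, Finset.mem_Icc.2 ⟨h1, by omega⟩⟩, ⟨j, Finset.mem_Icc.2 ⟨h3, h4⟩⟩) h2
    exact h1.comap_le
  · have h1 : Measurable[𝓕 {p | (p.1 : ℕ) = k + 1}]
        (fun s => fun j : Fin N => ω (k + 1) (j + 1) s) := by
      refine @measurable_pi_lambda _ _ _ (𝓕 {p | (p.1 : ℕ) = k + 1}) _ _ fun j => ?_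
      exact hle _ (⟨k + 1, Finset.mem_Icc.2 ⟨by omega, hk⟩⟩,
        ⟨j + 1, Finset.mem_Icc.2 ⟨by omega, by omega⟩⟩) rfl
    exact h1.comap_le

theorem map_row_eq_pi [IsProbabilityMeasure P] (hω : ∀ i j, Measurable (ω i j))
    (hlaw : ∀ i ∈ Finset.Icc 1 m, ∀ j ∈ Finset.Icc 1 N,
      P.map (ω i j) = expMeasure (α i + β j))
    (hindep : iIndepFun
      (fun p : Finset.Icc 1 m × Finset.Icc 1 N => ω (p.1 : ℕ) (p.2 : ℕ)) P)
    {k : ℕ} (hk : k + 1 ≤ m) :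
    P.map (fun s => fun j : Fin N => ω (k + 1) (j + 1) s) =
      Measure.pi fun j : Fin N => expMeasure (α (k + 1) + β (j + 1)) := by
  have hk' : k + 1 ∈ Finset.Icc 1 m := Finset.mem_Icc.2 ⟨by omega, hk⟩
  have hj : ∀ j : Fin N, (j : ℕ) + 1 ∈ Finset.Icc 1 N := fun j =>
    Finset.mem_Icc.2 ⟨by omega, by omega⟩
  have h := hindep.precomp (g := fun j : Fin N =>
    ((⟨k + 1, hk'⟩, ⟨j + 1, hj j⟩) : Finset.Icc 1 m × Finset.Icc 1 N)) fun i j hij => by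
      simpa [Fin.ext_iff] using hij
  rw [iIndepFun_iff_map_fun_eq_pi_map fun j => (hω _ _).aemeasurable] at h
  rw [h]
  congr 1
  ext1 j
  exact hlaw _ hk' _ (hj j)

theorem measurable_det_expMatrix (hR : 0 ≤ R) (hα : ∀ k ∈ Finset.Icc 1 m, |α k| < R)
    (hβ : ∀ k ∈ Finset.Icc 1 N, |β k| < R) :
    Measurable fun y : Fin N → ℝ => (expMatrix N α β m R x y).det := by
  refine measurable_det_of_measurable fun i j => ?_
  have hc := measurable_causalFun (j := j + 1) hR hα
    fun k hk => hβ k (Finset.Icc_subset_Icc_right (show (i : ℕ) + 1 ≤ N by omega) hk)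
  simp only [expMatrix, Matrix.of_apply, expEntry_eq]
  have h1 : Measurable fun y : Fin N → ℝ => y j := measurable_pi_apply j
  have h2 : Measurable fun y : Fin N → ℝ =>
      causalFun α β R m (i + 1) (j + 1) (y j - x (i + 1)) := hc.comp (h1.sub_const _)
  have h3 : Measurable fun y : Fin N → ℝ => Complex.exp (-(β (j + 1) * y j)) :=
    (by fun_prop : Continuous fun t : ℝ => Complex.exp (-(β (j + 1) * t))).measurable.comp h1
  exact ((h3.mul_const _).mul h2).const_mul _

/-- The complex convolution identity has a real non-negative integrand by `hdet`. This gives the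
sign for `m + 1` and allows the integral to be read as a `lintegral`. -/
theorem det_expMatrix_succ_eq (hR : 0 < R)
    (hαβ : ∀ j ∈ Finset.Icc 1 N, 0 < α (m + 1) + β j)
    (hα : ∀ k ∈ Finset.Icc 1 (m + 1), |α k| < R)
    (hβ : ∀ k ∈ Finset.Icc 1 N, |β k| < R) (hm : 1 ≤ m)
    (hx : ∀ i j, 1 ≤ i → i ≤ j → j ≤ N → x i ≤ x j) (hL : L < x 1)
    (hdet : ∀ y ∈ weylChamber N, (expMatrix N α β m R x y).det.im = 0 ∧
      0 ≤ (expMatrix N α β m R x y).det.re)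
    {z : Fin N → ℝ} (hz : z ∈ weylChamber N) :
    ((expMatrix N α β (m + 1) R x z).det.im = 0 ∧
      0 ≤ (expMatrix N α β (m + 1) R x z).det.re) ∧
    ENNReal.ofReal (expMatrix N α β (m + 1) R x z).det.re = ∫⁻ y in weylChamber N,
      ENNReal.ofReal (expMatrix N α β m R x y).det.re *
        ENNReal.ofReal (stepDensity (fun j => α (m + 1) + β j) L y z) := by
  obtain ⟨hint, hval⟩ := integral_det_expMatrix_mul_stepDensity hR hα hβ hm hx hL hz
  have hSnn : ∀ y : Fin N → ℝ, 0 ≤ stepDensity (fun j => α (m + 1) + β j) L y z := fun y =>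
    Finset.prod_nonneg fun j _ => exponentialPDFReal_nonneg
      (hαβ _ (Finset.mem_Icc.2 ⟨by omega, by omega⟩)) _
  set h : (Fin N → ℝ) → ℝ := (weylChamber N).indicator fun y =>
    (expMatrix N α β m R x y).det.re * stepDensity (fun j => α (m + 1) + β j) L y z with hh
  have hh0 : ∀ y, 0 ≤ h y := fun y =>
    Set.indicator_nonneg (fun y hy => mul_nonneg (hdet y hy).2 (hSnn y)) y
  have hcoe : ((weylChamber N).indicator fun y => (expMatrix N α β m R x y).det *
        (stepDensity (fun j => α (m + 1) + β j) L y z : ℂ)) = fun y => (h y : ℂ) := by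
    ext1 y
    by_cases hy : y ∈ weylChamber N
    · have hre : (expMatrix N α β m R x y).det = ((expMatrix N α β m R x y).det.re : ℂ) :=
        Complex.ext rfl (by simpa using (hdet y hy).1)
      rw [hh, Set.indicator_of_mem hy, Set.indicator_of_mem hy, Complex.ofReal_mul, ← hre]
    · rw [hh, Set.indicator_of_notMem hy, Set.indicator_of_notMem hy, Complex.ofReal_zero]
  rw [hcoe] at hint hval
  have hhint : Integrable h := hint.re
  replace hval : ((∫ y, h y : ℝ) : ℂ) = (expMatrix N α β (m + 1) R x z).det :=
    integral_ofReal.symm.trans hval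
  have hlint : ENNReal.ofReal (∫ y, h y) = ∫⁻ y in weylChamber N,
      ENNReal.ofReal (expMatrix N α β m R x y).det.re *
        ENNReal.ofReal (stepDensity (fun j => α (m + 1) + β j) L y z) := by
    rw [ofReal_integral_eq_lintegral_ofReal hhint (Filter.Eventually.of_forall hh0),
      ← lintegral_indicator (measurableSet_weylChamber N)]
    refine lintegral_congr fun y => ?_
    by_cases hy : y ∈ weylChamber N
    · rw [hh, Set.indicator_of_mem hy, Set.indicator_of_mem hy,
        ENNReal.ofReal_mul (hdet y hy).2]
    · rw [hh, Set.indicator_of_notMem hy, Set.indicator_of_notMem hy, ENNReal.ofReal_zero]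
  rw [← hval]
  exact ⟨⟨Complex.ofReal_im _, integral_nonneg hh0⟩, by rw [← hlint, Complex.ofReal_re]⟩

theorem det_expMatrix_nonneg_and_map_lppVec [IsProbabilityMeasure P] (hR : 0 < R)
    (hαβ : ∀ i ∈ Finset.Icc 1 m, ∀ j ∈ Finset.Icc 1 N, 0 < α i + β j)
    (hα : ∀ k ∈ Finset.Icc 1 m, |α k| < R) (hβ : ∀ k ∈ Finset.Icc 1 N, |β k| < R)
    (hω : ∀ i j, Measurable (ω i j))
    (hlaw : ∀ i ∈ Finset.Icc 1 m, ∀ j ∈ Finset.Icc 1 N,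
      P.map (ω i j) = expMeasure (α i + β j))
    (hindep : iIndepFun
      (fun p : Finset.Icc 1 m × Finset.Icc 1 N => ω (p.1 : ℕ) (p.2 : ℕ)) P)
    (hx : ∀ i j, 1 ≤ i → i ≤ j → j ≤ N → x i ≤ x j) (hL : L < x 1)
    {k : ℕ} (hk1 : 1 ≤ k) (hkm : k ≤ m) :
    (∀ y ∈ weylChamber N, (expMatrix N α β k R x y).det.im = 0 ∧
      0 ≤ (expMatrix N α β k R x y).det.re) ∧
    P.map (fun s => lppVec N L x (fun i j => ω i j s) k) =
      (volume.restrict (weylChamber N)).withDensity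
        fun y => ENNReal.ofReal (expMatrix N α β k R x y).det.re := by
  have hrow : ∀ k, Measurable fun s => fun j : Fin N => ω k (j + 1) s := fun k =>
    measurable_pi_iff.2 fun j => hω _ _
  have hrate : ∀ k, k + 1 ≤ m → ∀ j ∈ Finset.Icc 1 N, 0 < α (k + 1) + β j := fun k hk j hj =>
    hαβ _ (Finset.mem_Icc.2 ⟨by omega, hk⟩) j hj
  have hfin : ∀ j : Fin N, (j : ℕ) + 1 ∈ Finset.Icc 1 N := fun j =>
    Finset.mem_Icc.2 ⟨by omega, by omega⟩
  induction k, hk1 using Nat.le_induction with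
  | base =>
    have hα1 : |α 1| < R := hα 1 (Finset.mem_Icc.2 ⟨le_rfl, hkm⟩)
    have hnn : ∀ z : Fin N → ℝ,
        0 ≤ stepDensity (fun j => α 1 + β j) L (fun j : Fin N => x (j + 1)) z := fun z =>
      Finset.prod_nonneg fun j _ => exponentialPDFReal_nonneg (hrate 0 hkm _ (hfin j)) _
    refine ⟨fun y hy => ?_, ?_⟩
    · rw [det_expMatrix_one hR hα1 hβ hx hL hy]
      exact ⟨Complex.ofReal_im _, hnn y⟩
    · have := map_stepVec_const_eq_withDensity (L := L) (r := fun j => α 1 + β j)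
        (fun j => hrate 0 hkm _ (hfin j)) (hrow 1) (map_row_eq_pi hω hlaw hindep hkm)
        fun j : Fin N => x (j + 1)
      rw [← withDensity_indicator (measurableSet_weylChamber N)]
      refine this.trans ?_
      congr 1
      ext1 z
      by_cases hz : z ∈ weylChamber N
      · rw [Set.indicator_of_mem hz, det_expMatrix_one hR hα1 hβ hx hL hz, Complex.ofReal_re]
      · rw [Set.indicator_of_notMem hz, stepDensity_of_notMem_weylChamber hz,
          ENNReal.ofReal_zero]
  | succ k hk ih =>
    obtain ⟨ih1, ih2⟩ := ih (by omega)
    have hα' : ∀ l ∈ Finset.Icc 1 (k + 1), |α l| < R := fun l hl =>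
      hα l (Finset.Icc_subset_Icc_right hkm hl)
    have hstep := fun (z : Fin N → ℝ) (hz : z ∈ weylChamber N) =>
      det_expMatrix_succ_eq hR (hrate k hkm) hα' hβ hk hx hL ih1 hz
    refine ⟨fun z hz => (hstep z hz).1, ?_⟩
    have hp : Measurable fun y : Fin N → ℝ => (expMatrix N α β k R x y).det.re :=
      Complex.measurable_re.comp (measurable_det_expMatrix hR.le
        (fun l hl => hα l (Finset.Icc_subset_Icc_right (by omega) hl)) hβ)
    have := map_stepVec_eq_withDensity (L := L) (r := fun j => α (k + 1) + β j)
      (fun j => hrate k hkm _ (hfin j)) (measurable_lppVec fun i j _ _ _ _ => hω i j)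
      (hrow (k + 1)) (indepFun_lppVec_row hω hindep hkm) hp ih2
      (map_row_eq_pi hω hlaw hindep hkm)
    rw [← withDensity_indicator (measurableSet_weylChamber N)]
    refine this.trans ?_
    congr 1
    ext1 z
    by_cases hz : z ∈ weylChamber N
    · rw [Set.indicator_of_mem hz, (hstep z hz).2]
    · rw [Set.indicator_of_notMem hz]
      simp [stepDensity_of_notMem_weylChamber hz]

theorem ae_nonneg_of_map_eq_expMeasure {X : Ω → ℝ} (hX : Measurable X) {r : ℝ}
    (h : P.map X = expMeasure r) : ∀ᵐ s ∂P, 0 ≤ X s := by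
  refine ae_of_ae_map hX.aemeasurable (p := fun t : ℝ => 0 ≤ t) ?_
  have hzero : expMeasure r (Set.Iio 0) = 0 :=
    (withDensity_apply _ measurableSet_Iio).trans (lintegral_exponentialPDF_of_nonpos le_rfl)
  rw [h, ae_iff]
  simp only [not_le]
  exact hzero

theorem det_expMatrix_nonneg_and_hasLaw_growthVec [IsProbabilityMeasure P] (hm : 1 ≤ m) (hR : 0 < R)
    (hαβ : ∀ i ∈ Finset.Icc 1 m, ∀ j ∈ Finset.Icc 1 N, 0 < α i + β j)
    (hα : ∀ k ∈ Finset.Icc 1 m, |α k| < R) (hβ : ∀ k ∈ Finset.Icc 1 N, |β k| < R)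
    (hlaw : ∀ i ∈ Finset.Icc 1 m, ∀ j ∈ Finset.Icc 1 N,
      HasLaw (ω i j) (expMeasure (α i + β j)) P)
    (hindep : iIndepFun
      (fun p : Finset.Icc 1 m × Finset.Icc 1 N => ω (p.1 : ℕ) (p.2 : ℕ)) P)
    (hx : (fun j : Fin N => x ((j : ℕ) + 1)) ∈ weylChamber N)
    {c : WithBot ℝ} (hc : c ≤ (x 1 : WithBot ℝ)) :
    (∀ y ∈ weylChamber N,
      (expMatrix N α β m R x y).det.im = 0 ∧ 0 ≤ (expMatrix N α β m R x y).det.re) ∧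
    HasLaw (fun s : Ω => growthVec N c x (fun i j => ω i j s) m)
      ((volume.restrict (weylChamber N)).withDensity
        (fun y => ENNReal.ofReal (expMatrix N α β m R x y).det.re)) P := by
  classical
  have hx' : ∀ i j, 1 ≤ i → i ≤ j → j ≤ N → x i ≤ x j := by
    intro i j hi hij hj
    have := hx (show (⟨i - 1, by omega⟩ : Fin N) ≤ ⟨j - 1, by omega⟩ from Nat.sub_le_sub_right hij 1)
    simpa [Nat.sub_add_cancel hi, Nat.sub_add_cancel (hi.trans hij)] using this
  -- The weights are only almost everywhere measurable, and only for indices in range; they are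
  -- replaced by measurable versions, with `0` elsewhere.
  have hmod : ∀ i j, ∃ f : Ω → ℝ, Measurable f ∧
      (i ∈ Finset.Icc 1 m → j ∈ Finset.Icc 1 N → ω i j =ᵐ[P] f) := by
    intro i j
    by_cases h : i ∈ Finset.Icc 1 m ∧ j ∈ Finset.Icc 1 N
    · obtain ⟨f, hf, hωf⟩ := (hlaw i h.1 j h.2).aemeasurable
      exact ⟨f, hf, fun _ _ => hωf⟩
    · exact ⟨0, measurable_zero, fun h1 h2 => absurd ⟨h1, h2⟩ h⟩
  choose ω' hω' hωω' using hmod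
  have hlaw' : ∀ i ∈ Finset.Icc 1 m, ∀ j ∈ Finset.Icc 1 N,
      P.map (ω' i j) = expMeasure (α i + β j) := fun i hi j hj =>
    (Measure.map_congr (hωω' i j hi hj)).symm.trans (hlaw i hi j hj).map_eq
  have hindep' : iIndepFun
      (fun p : Finset.Icc 1 m × Finset.Icc 1 N => ω' (p.1 : ℕ) (p.2 : ℕ)) P :=
    (iIndepFun_congr fun p => hωω' _ _ p.1.2 p.2.2).1 hindep
  -- Any `L` strictly below `x 1` would do; strictness is what cuts off the boundary terms.
  obtain ⟨hdet, hmap⟩ := det_expMatrix_nonneg_and_map_lppVec (L := x 1 - 1) hR hαβ hα hβ hω'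
    hlaw' hindep' hx' (by linarith) hm le_rfl
  have hae : (fun s : Ω => growthVec N c x (fun i j => ω i j s) m) =ᵐ[P]
      fun s => lppVec N (x 1 - 1) x (fun i j => ω' i j s) m := by
    have h1 : ∀ᵐ s ∂P, ∀ i j, i ∈ Finset.Icc 1 m → j ∈ Finset.Icc 1 N →
        ω i j s = ω' i j s ∧ 0 ≤ ω' i j s := by
      refine ae_all_iff.2 fun i => ae_all_iff.2 fun j => ?_
      by_cases h : i ∈ Finset.Icc 1 m ∧ j ∈ Finset.Icc 1 N
      · filter_upwards [hωω' i j h.1 h.2,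
          ae_nonneg_of_map_eq_expMeasure (hω' i j) (hlaw' i h.1 j h.2)] with s h1 h2 _ _
        exact ⟨h1, h2⟩
      · exact Filter.Eventually.of_forall fun s h1 h2 => absurd ⟨h1, h2⟩ h
    filter_upwards [h1] with s hs
    have hIcc : ∀ i n, 1 ≤ i → i ≤ n → i ∈ Finset.Icc 1 n := fun i n h1 h2 =>
      Finset.mem_Icc.2 ⟨h1, h2⟩
    have hlpp : ∀ k ≤ m, lppVec N (x 1 - 1) x (fun i j => ω i j s) k =
        lppVec N (x 1 - 1) x (fun i j => ω' i j s) k := by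
      intro k hk
      induction k with
      | zero => rfl
      | succ k ih =>
        rw [lppVec, lppVec, ih (by omega)]
        congr 1
        ext j
        exact (hs _ _ (hIcc _ _ (by omega) hk) (hIcc _ _ (by omega) j.2)).1
    rw [← hlpp m le_rfl]
    ext j
    have := (growth_eq_lppVec (N := N) (L := x 1 - 1) (w := fun i j => ω i j s) (k := m) hc
      (by linarith) fun i j h1 h2 h3 h4 => by
        have := hs i j (hIcc _ _ h1 h2) (hIcc _ _ h3 h4)
        rw [this.1]
        exact this.2).1 j j.2
    rw [growthVec, this]
    rfl
  exact ⟨hdet, ⟨_, measurable_lppVec fun i j _ _ _ _ => hω' i j, hae⟩,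
    (Measure.map_congr hae).trans hmap⟩

end law

theorem mainTheorem9 {Ω : Type*} [MeasurableSpace Ω] (P : Measure Ω) [IsProbabilityMeasure P]
    (N m : ℕ) (hm : 1 ≤ m) (α β : ℕ → ℝ)
    (hαβ : ∀ i ∈ Finset.Icc 1 m, ∀ j ∈ Finset.Icc 1 N, 0 < α i + β j)
    (ω : ℕ → ℕ → Ω → ℝ)
    (hlaw : ∀ i ∈ Finset.Icc 1 m, ∀ j ∈ Finset.Icc 1 N,
      HasLaw (ω i j) (expMeasure (α i + β j)) P)
    (hindep : iIndepFun
      (fun p : Finset.Icc 1 m × Finset.Icc 1 N => ω (p.1 : ℕ) (p.2 : ℕ)) P)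
    (x : ℕ → ℝ) (hx : (fun j : Fin N => x ((j : ℕ) + 1)) ∈ weylChamber N)
    (c : WithBot ℝ) (hc : c ≤ (x 1 : WithBot ℝ))
    (R : ℝ) (hRα : ∀ k ∈ Finset.Icc 1 m, α k < R) (hRβ : ∀ l ∈ Finset.Icc 1 N, β l < R) :
    (∀ y ∈ weylChamber N,
      (expMatrix N α β m R x y).det.im = 0 ∧ 0 ≤ (expMatrix N α β m R x y).det.re) ∧
    HasLaw (fun s : Ω => growthVec N c x (fun i j => ω i j s) m)
      ((volume.restrict (weylChamber N)).withDensity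
        (fun y => ENNReal.ofReal (expMatrix N α β m R x y).det.re)) P := by
  rcases Nat.eq_zero_or_pos N with rfl | hN
  -- Without any `β` the hypotheses do not force `R > 0`; but the matrix is empty, so the radius can
  -- be changed freely.
  · obtain ⟨R', hR', hα'⟩ : ∃ R' : ℝ, 0 < R' ∧ ∀ k ∈ Finset.Icc 1 m, |α k| < R' := by
      have hsum : 0 ≤ ∑ k ∈ Finset.Icc 1 m, |α k| := Finset.sum_nonneg fun _ _ => abs_nonneg _
      refine ⟨∑ k ∈ Finset.Icc 1 m, |α k| + 1, by linarith, fun k hk => ?_⟩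
      have := Finset.single_le_sum (f := fun k => |α k|) (fun _ _ => abs_nonneg _) hk
      linarith
    have hRR' : ∀ y, expMatrix 0 α β m R x y = expMatrix 0 α β m R' x y := fun y =>
      Subsingleton.elim _ _
    simp only [hRR']
    exact det_expMatrix_nonneg_and_hasLaw_growthVec hm hR' hαβ hα' (by simp) hlaw hindep hx hc
  · have h1m : 1 ∈ Finset.Icc 1 m := Finset.mem_Icc.2 ⟨le_rfl, hm⟩
    have h1N : 1 ∈ Finset.Icc 1 N := Finset.mem_Icc.2 ⟨le_rfl, hN⟩
    have hR : 0 < R := by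
      have h1 := hαβ 1 h1m 1 h1N
      have h2 := hRα 1 h1m
      have h3 := hRβ 1 h1N
      linarith
    refine det_expMatrix_nonneg_and_hasLaw_growthVec hm hR hαβ (fun k hk => ?_) (fun l hl => ?_)
      hlaw hindep hx hc
    -- The one-sided bounds on `R` are two-sided, since `α k > -β 1 > -R`; likewise for `β`.
    · have h1 := hαβ k hk 1 h1N
      have h2 := hRβ 1 h1N
      exact abs_lt.2 ⟨by linarith, hRα k hk⟩
    · have h1 := hαβ 1 h1m l hl
      have h2 := hRα 1 h1m
      exact abs_lt.2 ⟨by linarith, hRβ l hl⟩
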